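/- Let $d\ge 1$, let $B=(B_{ij})$ be a $d\times d$ matrix with entries in $[0,1]$, and let $(X_t)_{t\in\mathbb N_0}$ be a process with values in $\mathbb N_0^d$ on a probability space $(\Omega,\mathcal F,P)$ such that, for $t=1,2,\dots$ and $i=1,\dots,d$, $$X_{t,i}=\sum_{j=1}^d\sum_{s=1}^{X_{t-1,j}}Y_{t,s}^{i,j}+Z_{t,i}\quad\text{almost surely}.$$ Here the $Y_{t,s}^{i,j}$ ($t,s\ge 1$, $1\le i,j\le d$) are independent with $Y_{t,s}^{i,j}\sim\mathrm{Bin}(1,B_{ij})$; the $\mathbb N_0^d$-valued random vectors $Z_t=(Z_{t,1},\dots,Z_{t,d})^T$ ($t\ge 1$) are independent (but not necessarily identically distributed, and their components may be dependent); the family $(Z_t)_{t\ge1}$ is independent of the family $(Y_{t,s}^{i,j})$; and $X_0$ is independent of these two families jointly. Let $\sqrt B=(\sqrt{B_{ij}})$ be the entrywise square root and let $\rho$ denote the spectral radius. Assume (i) $\rho(\sqrt B)<1/2$; (ii) $E\sqrt{X_{0,i}}<\infty$ for $i=1,\dots,d$; (iii) $E\sqrt{Z_{t,i}}<\infty$ for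 all $t\ge 1$, and $\sup_{t\ge 1}E\big|\sqrt{Z_{t,i}}-E\sqrt{Z_{t,i}}\big|<\infty$, for $i=1,\dots,d$. For sub-$\sigma$-algebras $\mathcal A_1,\mathcal A_2$ of $\mathcal F$ let $\beta(\mathcal A_1,\mathcal A_2)=E\big[\sup\{|P(C\mid\mathcal A_1)-P(C)|: C\in\mathcal A_2\}\big]$, and let $$\beta^X(n)=\sup_{k\in\mathbb N_0}\beta\big(\sigma(X_0,\dots,X_k),\,\sigma(X_{k+n},X_{k+n+1},\dots)\big).$$ Then $(X_t)_{t\in\mathbb N_0}$ is absolutely regular, that is, $\beta^X(n)\to 0$ as $n\to\infty$, and for every $\kappa>2\rho(\sqrt B)$ one has $\beta^X(n)=O(\kappa^n)$. -/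

import Mathlib

open MeasureTheory ProbabilityTheory Filter
open scoped ENNReal NNReal Topology

noncomputable section

namespace CountProcess

/-- The coefficient of absolute regularity `β(𝒜₁, 𝒜₂) = E[sup {|P(B | 𝒜₁) - P(B)| : B ∈ 𝒜₂}]`
of two sub-σ-algebras, as an element of `[0, ∞]`.

The supremum is taken over Mathlib's versions of the conditional probabilities. If `𝒜₁` is
generated by a countable partition (as it is for the past of a process with countably many
states up to a finite time), then `P(B | 𝒜₁)` is constant on every cell, equal to `P(B ∩ cell) / P(cell)`
on every cell of positive probability, so the choice of versions is immaterial. -/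
def betaCoeff {Ω : Type*} [MeasurableSpace Ω] (μ : Measure Ω) (m₁ m₂ : MeasurableSpace Ω) : ℝ≥0∞ :=
  ∫⁻ ω, ⨆ (B : Set Ω) (_ : MeasurableSet[m₂] B), ENNReal.ofReal |(μ⟦B | m₁⟧) ω - μ.real B| ∂μ

/-- `σ(X_0, …, X_k)`. -/
abbrev past {Ω S : Type*} [MeasurableSpace S] (X : ℕ → Ω → S) (k : ℕ) : MeasurableSpace Ω :=
  ⨆ j ∈ Set.Iic k, MeasurableSpace.comap (X j) inferInstance

/-- `σ(X_m, X_{m+1}, …)`. -/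
abbrev future {Ω S : Type*} [MeasurableSpace S] (X : ℕ → Ω → S) (m : ℕ) : MeasurableSpace Ω :=
  ⨆ j ∈ Set.Ici m, MeasurableSpace.comap (X j) inferInstance

/-- `β^X(k, n) = β(σ(X_0, …, X_k), σ(X_{k+n}, X_{k+n+1}, …))`. -/
def betaAt {Ω S : Type*} [MeasurableSpace Ω] [MeasurableSpace S] (μ : Measure Ω)
    (X : ℕ → Ω → S) (k n : ℕ) : ℝ≥0∞ :=
  betaCoeff μ (past X k) (future X (k + n))

/-- `β^X(n) = sup {β^X(k, n) : k ∈ ℕ₀}`. -/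
def beta {Ω S : Type*} [MeasurableSpace Ω] [MeasurableSpace S] (μ : Measure Ω)
    (X : ℕ → Ω → S) (n : ℕ) : ℝ≥0∞ :=
  ⨆ k : ℕ, betaAt μ X k n

/-- The process `X` is absolutely regular (β-mixing): `β^X(n) → 0` as `n → ∞`. -/
def AbsolutelyRegular {Ω S : Type*} [MeasurableSpace Ω] [MeasurableSpace S] (μ : Measure Ω)
    (X : ℕ → Ω → S) : Prop :=
  Tendsto (beta μ X) atTop (𝓝 0)

/-- The `d`-variate GINAR(1) model `X_t = B ∘ X_{t-1} + Z_t`, `t ≥ 1`, with Bernoulli thinning: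
`X_{t,i} = ∑_j ∑_{s=1}^{X_{t-1,j}} Y_{t,s}^{i,j} + Z_{t,i}`.

`Z t ω i` is `Z_{t,i}` and `Y t s i j ω` is `Y_{t,s}^{i,j}`. Only the indices `t ≥ 1` and `s ≥ 1`
of `Z` and `Y` occur in the model; nothing is assumed about the others, which is why all the
conditions below are written with `t + 1` and `s + 1`. -/
structure IsGINAR {Ω : Type*} [MeasurableSpace Ω] (μ : Measure Ω) {d : ℕ}
    (B : Matrix (Fin d) (Fin d) ℝ) (X : ℕ → Ω → Fin d → ℕ) (Z : ℕ → Ω → Fin d → ℕ)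
    (Y : ℕ → ℕ → Fin d → Fin d → Ω → ℕ) : Prop where
  /-- The entries of `B` are probabilities. -/
  mem_unitInterval : ∀ i j, B i j ∈ unitInterval
  measurable_X : ∀ t, Measurable (X t)
  measurable_Z : ∀ t, Measurable (Z (t + 1))
  measurable_Y : ∀ t s i j, Measurable (Y (t + 1) (s + 1) i j)
  /-- The count variable `Y_{t,s}^{i,j}` has the distribution `Bin(1, B_{ij})`. -/
  law_Y : ∀ t s i j,
    HasLaw (Y (t + 1) (s + 1) i j) (bernoulliMeasure 1 0 ⟨B i j, mem_unitInterval i j⟩) μ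
  /-- The count variables are independent. -/
  indep_Y : iIndepFun
    (fun (p : ℕ × ℕ × Fin d × Fin d) => Y (p.1 + 1) (p.2.1 + 1) p.2.2.1 p.2.2.2) μ
  /-- The covariate vectors `Z_1, Z_2, …` are independent. -/
  indep_Z : iIndepFun (fun t : ℕ => Z (t + 1)) μ
  /-- The covariates are independent of the count variables. -/
  indep_Z_Y : IndepFun (fun ω (t : ℕ) => Z (t + 1) ω)
    (fun ω (p : ℕ × ℕ × Fin d × Fin d) => Y (p.1 + 1) (p.2.1 + 1) p.2.2.1 p.2.2.2 ω) μ
  /-- The initial value is independent of the covariates and the count variables. -/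
  indep_X_zero : IndepFun (X 0)
    (fun ω => ((fun (t : ℕ) => Z (t + 1) ω),
      (fun (p : ℕ × ℕ × Fin d × Fin d) => Y (p.1 + 1) (p.2.1 + 1) p.2.2.1 p.2.2.2 ω))) μ
  /-- The model equation, almost surely. -/
  model : ∀ t, ∀ᵐ ω ∂μ, ∀ i,
    X (t + 1) ω i =
      (∑ j, ∑ s ∈ Finset.range (X t ω j), Y (t + 1) (s + 1) i j ω) + Z (t + 1) ω i

/-- The spectral radius `ρ(M)` of a real square matrix: the largest modulus of its complex
eigenvalues. -/
def rho {d : ℕ} (M : Matrix (Fin d) (Fin d) ℝ) : ℝ≥0∞ :=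
  spectralRadius ℂ (M.map (algebraMap ℝ ℂ))

/-- The entrywise square root of a matrix. -/
def sqrtMatrix {d : ℕ} (M : Matrix (Fin d) (Fin d) ℝ) : Matrix (Fin d) (Fin d) ℝ :=
  M.map Real.sqrt

/-- The parameter and moment condition: `ρ(√B) < 1/2`, `E √X_{0,i} < ∞` and
`sup_{t ≥ 1} E |√Z_{t,i} - E √Z_{t,i}| < ∞`, where `E √Z_{t,i} < ∞` for all `t ≥ 1`. -/
structure MomentCondition {Ω : Type*} [MeasurableSpace Ω] (μ : Measure Ω) {d : ℕ}
    (B : Matrix (Fin d) (Fin d) ℝ) (X₀ : Ω → Fin d → ℕ) (Z : ℕ → Ω → Fin d → ℕ) : Prop where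
  rho_lt : rho (sqrtMatrix B) < 1 / 2
  integrable_sqrt_X_zero : ∀ i, Integrable (fun ω => √(X₀ ω i : ℝ)) μ
  integrable_sqrt_Z : ∀ t i, Integrable (fun ω => √(Z (t + 1) ω i : ℝ)) μ
  bounded_Z : ∀ i, ∃ C : ℝ, ∀ t,
    ∫ ω, |√(Z (t + 1) ω i : ℝ) - ∫ ω', √(Z (t + 1) ω' i : ℝ) ∂μ| ∂μ ≤ C

end CountProcess

end

namespace CountProcess

section Matrix

attribute [local instance] Matrix.linftyOpNormedRing Matrix.linftyOpNormedAlgebra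

theorem exists_abs_pow_apply_le {d : ℕ} (M : Matrix (Fin d) (Fin d) ℝ) {κ : ℝ}
    (h : rho M < ENNReal.ofReal κ) :
    ∃ C : ℝ, 0 ≤ C ∧ ∀ n i j, |(M ^ n) i j| ≤ C * κ ^ n := by
  have hκ : 0 < κ := ENNReal.ofReal_pos.1 (lt_of_le_of_lt (zero_le) h)
  set N : Matrix (Fin d) (Fin d) ℂ := M.map (algebraMap ℝ ℂ) with hN
  have hpow : ∀ n, N ^ n = (M ^ n).map (algebraMap ℝ ℂ) := fun n =>
    (map_pow (RingHom.mapMatrix (algebraMap ℝ ℂ)) M n).symm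
  have hentry : ∀ n i j, |(M ^ n) i j| ≤ ‖N ^ n‖ := by
    intro n i j
    have h1 : |(M ^ n) i j| = ‖(N ^ n) i j‖ := by simp [hpow]
    rw [h1, ← coe_nnnorm, ← coe_nnnorm, NNReal.coe_le_coe, Matrix.linfty_opNNNorm_def]
    exact (Finset.single_le_sum (f := fun j => ‖(N ^ n) i j‖₊) (fun _ _ => zero_le)
      (Finset.mem_univ j)).trans (Finset.le_sup (f := fun i => ∑ j, ‖(N ^ n) i j‖₊)
        (Finset.mem_univ i))
  have : ∀ᶠ n : ℕ in atTop, ‖N ^ n‖ ≤ κ ^ n := by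
    have ht := spectrum.pow_nnnorm_pow_one_div_tendsto_nhds_spectralRadius N
    filter_upwards [ht.eventually (gt_mem_nhds h), eventually_ge_atTop 1] with n hn hn1
    have hn0 : (n : ℝ) ≠ 0 := by positivity
    have h2 := ENNReal.rpow_le_rpow hn.le (Nat.cast_nonneg n)
    rw [← ENNReal.rpow_mul, one_div_mul_cancel hn0, ENNReal.rpow_one, ENNReal.rpow_natCast,
      ← ENNReal.ofReal_pow hκ.le] at h2
    rw [← ENNReal.ofReal_le_ofReal_iff (by positivity), ofReal_norm]
    exact h2
  obtain ⟨m, hm⟩ := eventually_atTop.1 this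
  refine ⟨1 + ∑ k ∈ Finset.range m, ‖N ^ k‖ / κ ^ k, by positivity, fun n i j => ?_⟩
  refine (hentry n i j).trans ?_
  rcases le_or_gt m n with hmn | hmn
  · refine (hm n hmn).trans (le_mul_of_one_le_left (by positivity) ?_)
    have : 0 ≤ ∑ k ∈ Finset.range m, ‖N ^ k‖ / κ ^ k := by positivity
    linarith
  · rw [← div_le_iff₀ (by positivity)]
    have := Finset.single_le_sum (f := fun k => ‖N ^ k‖ / κ ^ k) (fun _ _ => by positivity)
      (Finset.mem_range.2 hmn)
    linarith

end Matrix

variable {d : ℕ}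

theorem sqrtMatrix_pow_nonneg (B : Matrix (Fin d) (Fin d) ℝ) (n : ℕ) (i j : Fin d) :
    0 ≤ (sqrtMatrix B ^ n) i j := by
  induction n generalizing i j with
  | zero => simp only [pow_zero, Matrix.one_apply]; split_ifs <;> norm_num
  | succ n ih =>
    rw [pow_succ, Matrix.mul_apply]
    exact Finset.sum_nonneg fun l _ => mul_nonneg (ih i l) (Real.sqrt_nonneg _)

theorem pow_apply_nonneg {B : Matrix (Fin d) (Fin d) ℝ} (hB : ∀ i j, 0 ≤ B i j)
    (n : ℕ) (i j : Fin d) : 0 ≤ (B ^ n) i j := by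
  induction n generalizing i j with
  | zero => simp only [pow_zero, Matrix.one_apply]; split_ifs <;> norm_num
  | succ n ih =>
    rw [pow_succ, Matrix.mul_apply]
    exact Finset.sum_nonneg fun l _ => mul_nonneg (ih i l) (hB _ _)

theorem sum_sq_le_sq_sum_of_nonneg {ι : Type*} (s : Finset ι) (f : ι → ℝ) (hf : ∀ i ∈ s, 0 ≤ f i) :
    ∑ i ∈ s, f i ^ 2 ≤ (∑ i ∈ s, f i) ^ 2 := by
  classical
  induction s using Finset.induction_on with
  | empty => simp
  | insert a s ha ih =>
    rw [Finset.sum_insert ha, Finset.sum_insert ha]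
    have h1 := ih fun i hi => hf i (Finset.mem_insert_of_mem hi)
    have h2 := hf a (Finset.mem_insert_self a s)
    have h3 : 0 ≤ ∑ i ∈ s, f i :=
      Finset.sum_nonneg fun i hi => hf i (Finset.mem_insert_of_mem hi)
    nlinarith [mul_nonneg h2 h3]

theorem pow_apply_le_sqrtMatrix_pow_sq {B : Matrix (Fin d) (Fin d) ℝ} (hB : ∀ i j, 0 ≤ B i j)
    (n : ℕ) (i j : Fin d) : (B ^ n) i j ≤ (sqrtMatrix B ^ n) i j ^ 2 := by
  induction n generalizing i j with
  | zero => simp only [pow_zero, Matrix.one_apply]; split_ifs <;> norm_num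
  | succ n ih =>
    rw [pow_succ, pow_succ (sqrtMatrix B), Matrix.mul_apply, Matrix.mul_apply]
    calc ∑ l, (B ^ n) i l * B l j
        ≤ ∑ l, ((sqrtMatrix B ^ n) i l * sqrtMatrix B l j) ^ 2 := by
          refine Finset.sum_le_sum fun l _ => ?_
          rw [mul_pow, sqrtMatrix, Matrix.map_apply, Real.sq_sqrt (hB l j)]
          exact mul_le_mul_of_nonneg_right (ih i l) (hB l j)
      _ ≤ _ := sum_sq_le_sq_sum_of_nonneg _ _ fun l _ =>
          mul_nonneg (sqrtMatrix_pow_nonneg B n i l) (Real.sqrt_nonneg _)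

/-- An affine vector recursion `a (k+1) ≤ M a k + b` stays bounded when the powers of `M ≥ 0`
decay geometrically. -/
theorem exists_bound_of_affine_recursion {M : Matrix (Fin d) (Fin d) ℝ} (hM : ∀ i j, 0 ≤ M i j)
    {C κ : ℝ} (hC : 0 ≤ C) (hκ0 : 0 ≤ κ) (hκ : κ < 1) (hpow : ∀ n i j, |(M ^ n) i j| ≤ C * κ ^ n)
    (a : ℕ → Fin d → ℝ) (b : Fin d → ℝ)
    (hrec : ∀ k i, a (k + 1) i ≤ ∑ j, M i j * a k j + b i) :
    ∃ A : ℝ, 0 ≤ A ∧ ∀ k i, a k i ≤ A := by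
  have hMn : ∀ n i j, 0 ≤ (M ^ n) i j := pow_apply_nonneg hM
  have key : ∀ k i, a k i ≤ ∑ j, (M ^ k) i j * |a 0 j| +
      ∑ l ∈ Finset.range k, ∑ j, (M ^ l) i j * |b j| := by
    intro k
    induction k with
    | zero => intro i; simp [Matrix.one_apply, le_abs_self]
    | succ k ih =>
      intro i
      refine (hrec k i).trans ?_
      have h1 : ∑ j, M i j * a k j ≤ ∑ j, M i j * (∑ l, (M ^ k) j l * |a 0 l| +
          ∑ m ∈ Finset.range k, ∑ l, (M ^ m) j l * |b l|) :=
        Finset.sum_le_sum fun j _ => mul_le_mul_of_nonneg_left (ih j) (hM i j)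
      have h2 : ∀ (m : ℕ) (v : Fin d → ℝ), ∑ j, M i j * ∑ l, (M ^ m) j l * v l =
          ∑ l, (M ^ (m + 1)) i l * v l := by
        intro m v
        have := congrFun (Matrix.mulVec_mulVec v M (M ^ m)) i
        rw [← pow_succ'] at this
        exact this
      rw [Finset.sum_range_succ']
      simp only [mul_add, Finset.sum_add_distrib, h2] at h1
      have h3 : ∑ j, M i j * ∑ m ∈ Finset.range k, ∑ l, (M ^ m) j l * |b l| =
          ∑ m ∈ Finset.range k, ∑ l, (M ^ (m + 1)) i l * |b l| := by
        simp_rw [Finset.mul_sum (Finset.range k)]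
        rw [Finset.sum_comm]
        exact Finset.sum_congr rfl fun m _ => h2 m _
      rw [h3] at h1
      have h4 : ∑ j, (M ^ 0) i j * |b j| = |b i| := by simp [Matrix.one_apply]
      have := le_abs_self (b i)
      linarith
  have hgeo : ∀ k, ∑ l ∈ Finset.range k, κ ^ l ≤ (1 - κ)⁻¹ := fun k => by
    rw [← tsum_geometric_of_lt_one hκ0 hκ]
    exact (summable_geometric_of_lt_one hκ0 hκ).sum_le_tsum _ fun _ _ => by positivity
  have h1κ : 0 ≤ (1 - κ)⁻¹ := inv_nonneg.2 (by linarith)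
  refine ⟨C * ∑ j, |a 0 j| + C * (1 - κ)⁻¹ * ∑ j, |b j|, by positivity, fun k i => ?_⟩
  refine (key k i).trans (add_le_add ?_ ?_)
  · rw [Finset.mul_sum]
    refine Finset.sum_le_sum fun j _ => mul_le_mul_of_nonneg_right ?_ (abs_nonneg _)
    exact (le_abs_self _).trans ((hpow k i j).trans
      (mul_le_of_le_one_right hC (pow_le_one₀ hκ0 hκ.le)))
  · calc ∑ l ∈ Finset.range k, ∑ j, (M ^ l) i j * |b j|
        ≤ ∑ l ∈ Finset.range k, (C * κ ^ l) * ∑ j, |b j| := by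
          refine Finset.sum_le_sum fun l _ => ?_
          rw [Finset.mul_sum]
          exact Finset.sum_le_sum fun j _ => mul_le_mul_of_nonneg_right
            ((le_abs_self _).trans (hpow l i j)) (abs_nonneg _)
      _ = C * (∑ l ∈ Finset.range k, κ ^ l) * ∑ j, |b j| := by
          rw [← Finset.sum_mul, ← Finset.mul_sum]
      _ ≤ _ := by gcongr; exact hgeo k

section Binomial

variable {Ω : Type*} [MeasurableSpace Ω] {P : Measure Ω} [IsProbabilityMeasure P]

theorem integral_abs_sub_le_sqrt_variance {N : Ω → ℝ} (hN : MemLp N 2 P) :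
    ∫ ω, |N ω - ∫ ω', N ω' ∂P| ∂P ≤ √(Var[N; P]) := by
  set m := ∫ ω', N ω' ∂P
  have hg : MemLp (fun ω => |N ω - m|) 2 P := (hN.sub (memLp_const m)).abs
  have h := variance_nonneg (fun ω => |N ω - m|) P
  rw [variance_eq_sub hg] at h
  refine Real.le_sqrt_of_sq_le ?_
  rw [variance_eq_integral hN.aemeasurable]
  simpa [sq_abs] using h

/-- The mean absolute deviation of a binomial variable, written as a sum of independent indicators,
is at most its standard deviation. -/
theorem integral_abs_sum_sub_le {ι : Type*} (A : ι → Ω → ℝ) (s : Finset ι) (p : ℝ)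
    (hA : ∀ l, Measurable (A l)) (h01 : ∀ l, ∀ᵐ ω ∂P, A l ω = 0 ∨ A l ω = 1)
    (hp : ∀ l, ∫ ω, A l ω ∂P = p) (hind : iIndepFun A P) :
    ∫ ω, |∑ l ∈ s, A l ω - s.card * p| ∂P ≤ √(s.card * (p * (1 - p))) := by
  have hL : ∀ l, MemLp (A l) 2 P := fun l =>
    MemLp.of_bound (hA l).aestronglyMeasurable 1 (by
      filter_upwards [h01 l] with ω h
      rcases h with h | h <;> simp [h])
  have hvar : ∀ l, Var[A l; P] = p * (1 - p) := fun l => by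
    rw [variance_eq_sub (hL l), hp l]
    have : ∫ ω, (A l ^ 2) ω ∂P = ∫ ω, A l ω ∂P := integral_congr_ae (by
      filter_upwards [h01 l] with ω h
      rcases h with h | h <;> simp [h])
    rw [this, hp l]; ring
  have hsum : MemLp (∑ l ∈ s, A l) 2 P := memLp_finsetSum' _ fun l _ => hL l
  have hmean : ∫ ω, (∑ l ∈ s, A l) ω ∂P = s.card * p := by
    simp only [Finset.sum_apply]
    rw [integral_finsetSum _ fun l _ => (hL l).integrable (by norm_num)]
    simp [hp]
  have h := integral_abs_sub_le_sqrt_variance hsum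
  rw [hmean, IndepFun.variance_sum (fun l _ => hL l) fun i _ j _ hij => hind.indepFun hij] at h
  simpa [hvar] using h

end Binomial

section Smoothing

variable {S : Type*} [MeasurableSpace S] [AddCommMonoid S] [MeasurableAdd₂ S]

/-- Sums of the first coordinates of a sequence. -/
def partialSum (z : ℕ) (ω : ℕ → S) : S := ∑ l ∈ Finset.range z, ω l

theorem measurable_partialSum (z : ℕ) : Measurable (partialSum (S := S) z) := by
  unfold partialSum; fun_prop

variable [MeasurableSingletonClass S] (ν : Measure S) [IsProbabilityMeasure ν]

/-- Removing any one summand that happens to vanish. -/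
theorem setIntegral_partialSum_succ {f : S → ℝ} (hf : Measurable f) {z l : ℕ} (hl : l ≤ z) :
    ∫ ω in {ω : ℕ → S | ω l = 0}, f (partialSum (z + 1) ω) ∂(Measure.infinitePi fun _ => ν) =
      ν.real {0} * ∫ ω, f (partialSum z ω) ∂(Measure.infinitePi fun _ => ν) := by
  set P := Measure.infinitePi fun _ : ℕ => ν
  have hm0 : ∀ l, MeasurableSet {ω : ℕ → S | ω l = 0} := fun l =>
    measurable_pi_apply l (measurableSet_singleton 0)
  have hind : iIndepFun (fun (l : ℕ) (ω : ℕ → S) => ω l) P :=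
    iIndepFun_infinitePi (X := fun _ x => x) (fun _ => measurable_id)
  have hmp : P.map (fun ω i => ω (Equiv.swap l z i)) = P :=
    Measure.map_infinitePi_infinitePi_of_inj (P := fun _ : ℕ => ν) (Equiv.swap l z).injective
  have hsw : Measurable fun (ω : ℕ → S) i => ω (Equiv.swap l z i) := by fun_prop
  have h1 : ∫ ω in {ω : ℕ → S | ω l = 0}, f (partialSum (z + 1) ω) ∂P =
      ∫ ω in {ω : ℕ → S | ω z = 0}, f (partialSum (z + 1) ω) ∂P := by
    have hFm : Measurable fun ω : ℕ → S => f (partialSum (z + 1) ω) :=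
      hf.comp (measurable_partialSum _)
    conv_rhs => rw [← hmp]
    rw [setIntegral_map (hm0 z) hFm.aestronglyMeasurable hsw.aemeasurable]
    have : (fun (ω : ℕ → S) i => ω (Equiv.swap l z i)) ⁻¹' {ω | ω z = 0} = {ω | ω l = 0} := by
      ext ω; simp
    rw [this]
    refine integral_congr_ae (ae_of_all _ fun ω => congrArg f ?_)
    refine (Finset.sum_equiv (Equiv.swap l z) (fun i => ?_) fun i _ => rfl).symm
    simp only [Finset.mem_range, Equiv.swap_apply_def]
    split_ifs <;> omega
  have hS : (fun ω : ℕ → S => partialSum z ω) = ∑ j ∈ Finset.range z, fun ω : ℕ → S => ω j := by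
    ext ω; simp [partialSum]
  have h2 : IndepFun (fun ω => partialSum z ω) (fun ω : ℕ → S => ω z) P := by
    rw [hS]; exact hind.indepFun_sum_range_succ (fun i => measurable_pi_apply i) z
  have h3 : IndepFun (fun ω => f (partialSum z ω))
      (fun ω : ℕ → S => ({0} : Set S).indicator (1 : S → ℝ) (ω z)) P :=
    h2.comp hf (measurable_one.indicator (measurableSet_singleton 0))
  have h4 : ∫ ω : ℕ → S, ({0} : Set S).indicator (1 : S → ℝ) (ω z) ∂P = ν.real {0} := by
    have h5 : P.map (fun ω : ℕ → S => ω z) = ν := Measure.infinitePi_map_eval (fun _ : ℕ => ν) z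
    conv_rhs => rw [← h5]
    rw [← integral_indicator_one (measurableSet_singleton 0), integral_map]
    · exact (measurable_pi_apply z).aemeasurable
    · exact (measurable_one.indicator (measurableSet_singleton 0)).aestronglyMeasurable
  rw [h1, mul_comm, ← h4, ← h3.integral_fun_mul_eq_mul_integral
    (hf.comp (measurable_partialSum z)).aestronglyMeasurable
    ((measurable_one.indicator (measurableSet_singleton 0)).comp
      (measurable_pi_apply z)).aestronglyMeasurable, ← integral_indicator (hm0 z)]
  refine integral_congr_ae (ae_of_all _ fun ω => ?_)
  by_cases h : ω z = 0
  · simp [h, partialSum, Finset.sum_range_succ]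
  · simp [h]

/-- Adding one more independent copy changes the law of a sum of `z` independent copies by
`O(√(q / z))` in total variation, where `q` is the probability that a copy does not vanish. -/
theorem abs_integral_partialSum_succ_sub_le {f : S → ℝ} (hf : Measurable f) (hf1 : ∀ x, |f x| ≤ 1)
    (hq : ν.real {0}ᶜ ≤ 1 / 2) (z : ℕ) :
    |∫ ω, f (partialSum (z + 1) ω) ∂(Measure.infinitePi fun _ => ν) -
      ∫ ω, f (partialSum z ω) ∂(Measure.infinitePi fun _ => ν)| ≤
      √(2 * ν.real {0}ᶜ) / √(z + 1) := by
  set P := Measure.infinitePi fun _ : ℕ => ν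
  set q := ν.real {0}ᶜ with hqdef
  have hq0 : 0 ≤ q := measureReal_nonneg
  have h0q : ν.real {0} = 1 - q := by
    rw [hqdef, probReal_compl_eq_one_sub (measurableSet_singleton 0)]; ring
  have hm0 : ∀ l, MeasurableSet {ω : ℕ → S | ω l = 0} := fun l =>
    measurable_pi_apply l (measurableSet_singleton 0)
  set g : S → ℝ := ({0}ᶜ : Set S).indicator 1 with hg
  have hgm : Measurable g := measurable_one.indicator (measurableSet_singleton 0).compl
  set A : ℕ → (ℕ → S) → ℝ := fun l ω => g (ω l) with hA
  have hAm : ∀ l, Measurable (A l) := fun l => hgm.comp (measurable_pi_apply l)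
  have h01 : ∀ l ω, A l ω = 0 ∨ A l ω = 1 := fun l ω => by
    by_cases h : ω l = 0 <;> simp [hA, hg, h]
  have hAp : ∀ l, ∫ ω, A l ω ∂P = q := fun l => by
    have h5 : P.map (fun ω : ℕ → S => ω l) = ν := Measure.infinitePi_map_eval (fun _ : ℕ => ν) l
    rw [hqdef, ← integral_indicator_one (measurableSet_singleton 0).compl]
    conv_rhs => rw [← h5]
    rw [integral_map (measurable_pi_apply l).aemeasurable hgm.aestronglyMeasurable]
  have hind : iIndepFun A P := iIndepFun_infinitePi (X := fun _ => g) (fun _ => hgm)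
  have hbin := integral_abs_sum_sub_le A (Finset.range (z + 1)) q hAm
    (fun l => ae_of_all _ (h01 l)) hAp hind
  rw [Finset.card_range] at hbin
  have hFm : Measurable fun ω : ℕ → S => f (partialSum (z + 1) ω) :=
    hf.comp (measurable_partialSum _)
  have hFi : Integrable (fun ω : ℕ → S => f (partialSum (z + 1) ω)) P :=
    Integrable.of_bound hFm.aestronglyMeasurable 1 (ae_of_all _ fun ω => hf1 _)
  have hFA : ∀ l, Integrable (fun ω => f (partialSum (z + 1) ω) * (1 - A l ω)) P := fun l =>
    Integrable.of_bound (hFm.mul (measurable_const.sub (hAm l))).aestronglyMeasurable 1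
      (ae_of_all _ fun ω => by
        rcases h01 l ω with h | h <;> simp [h, hf1])
  have hrem : ∀ l ∈ Finset.range (z + 1), ∫ ω, f (partialSum (z + 1) ω) * (1 - A l ω) ∂P =
      (1 - q) * ∫ ω, f (partialSum z ω) ∂P := fun l hl => by
    rw [← h0q, ← setIntegral_partialSum_succ ν hf (Nat.lt_succ_iff.1 (Finset.mem_range.1 hl)),
      ← integral_indicator (hm0 l)]
    refine integral_congr_ae (ae_of_all _ fun ω => ?_)
    by_cases h : ω l = 0 <;> simp [hA, hg, h]
  have hkey : ((z + 1 : ℕ) : ℝ) * (1 - q) * (∫ ω, f (partialSum (z + 1) ω) ∂P -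
      ∫ ω, f (partialSum z ω) ∂P) =
      ∫ ω, f (partialSum (z + 1) ω) * (∑ l ∈ Finset.range (z + 1), A l ω - (z + 1 : ℕ) * q) ∂P := by
    have h6 : ∑ l ∈ Finset.range (z + 1), ∫ ω, f (partialSum (z + 1) ω) * (1 - A l ω) ∂P =
        ((z + 1 : ℕ) : ℝ) * ((1 - q) * ∫ ω, f (partialSum z ω) ∂P) := by
      rw [Finset.sum_congr rfl hrem]; simp
    rw [← integral_finsetSum _ fun l _ => hFA l] at h6
    rw [mul_sub, mul_assoc _ _ (∫ ω, f (partialSum z ω) ∂P), ← h6, ← integral_const_mul,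
      ← integral_sub (hFi.const_mul _) (integrable_finsetSum _ fun l _ => hFA l)]
    refine integral_congr_ae (ae_of_all _ fun ω => ?_)
    simp only [← Finset.mul_sum, Finset.sum_sub_distrib, Finset.sum_const, Finset.card_range,
      nsmul_eq_mul, mul_one]
    ring
  have hle : |∫ ω, f (partialSum (z + 1) ω) *
      (∑ l ∈ Finset.range (z + 1), A l ω - (z + 1 : ℕ) * q) ∂P| ≤
      √((z + 1 : ℕ) * (q * (1 - q))) := by
    refine (abs_integral_le_integral_abs).trans (le_trans ?_ hbin)
    refine integral_mono_of_nonneg (ae_of_all _ fun ω => abs_nonneg _) ?_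
      (ae_of_all _ fun ω => ?_)
    · refine Integrable.of_bound (C := (z + 1 : ℕ) + (z + 1 : ℕ) * q) ?_ (ae_of_all _ fun ω => ?_)
      · exact ((Finset.measurable_fun_sum _ fun l _ => hAm l).sub
          measurable_const).abs.aestronglyMeasurable
      · rw [Real.norm_eq_abs, abs_abs]
        refine (abs_sub _ _).trans (add_le_add ?_ ?_)
        · refine (Finset.abs_sum_le_sum_abs _ _).trans ?_
          refine (Finset.sum_le_card_nsmul _ _ 1 fun l _ => ?_).trans (by simp)
          rcases h01 l ω with h | h <;> simp [h]
        · rw [abs_of_nonneg (by positivity)]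
    · simp only [abs_mul]
      exact mul_le_of_le_one_left (abs_nonneg _) (hf1 _)
  rw [← hkey, abs_mul, abs_of_nonneg (by have : 0 ≤ 1 - q := by linarith
                                         positivity)] at hle
  push_cast at hle
  have hz : (0 : ℝ) < z + 1 := by positivity
  rw [le_div_iff₀ (by positivity)]
  set D := |∫ ω, f (partialSum (z + 1) ω) ∂P - ∫ ω, f (partialSum z ω) ∂P|
  have hD : 0 ≤ D := abs_nonneg _
  refine Real.le_sqrt_of_sq_le ?_
  rw [mul_pow, Real.sq_sqrt hz.le]
  have h8 : ((z + 1) * (1 - q) * D) ^ 2 ≤ (z + 1) * (q * (1 - q)) := by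
    have h9 : (0 : ℝ) ≤ (z + 1) * (q * (1 - q)) :=
      mul_nonneg hz.le (mul_nonneg hq0 (by linarith))
    rw [← Real.sq_sqrt h9]
    exact pow_le_pow_left₀ (mul_nonneg (mul_nonneg hz.le (by linarith)) hD) hle 2
  have h10 : (z + 1) * (1 - q) * (D ^ 2 * (z + 1) * (1 - q)) ≤ (z + 1) * (1 - q) * q := by
    nlinarith
  have h11 := le_of_mul_le_mul_left h10 (mul_pos hz (by linarith))
  have h12 : 0 ≤ D ^ 2 * (z + 1) := by positivity
  nlinarith

end Smoothing

theorem abs_sub_le_of_abs_succ_sub_le {G : ℕ → ℝ} {c : ℝ} (hc : 0 ≤ c)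
    (h : ∀ z : ℕ, |G (z + 1) - G z| ≤ c / √(z + 1)) (a b : ℕ) :
    |G a - G b| ≤ 2 * c * |√(a : ℝ) - √(b : ℝ)| := by
  wlog hab : b ≤ a generalizing a b
  · rw [abs_sub_comm, abs_sub_comm (√(a : ℝ))]
    exact this b a (le_of_not_ge hab)
  rw [abs_of_nonneg (sub_nonneg.2 (Real.sqrt_le_sqrt (Nat.cast_le.2 hab)))]
  induction a, hab using Nat.le_induction with
  | base => simp
  | succ a hab ih =>
    have h1 : |G (a + 1) - G b| ≤ |G (a + 1) - G a| + |G a - G b| := abs_sub_le _ _ _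
    have h2 : c / √((a : ℝ) + 1) ≤ 2 * c * (√((a : ℝ) + 1) - √(a : ℝ)) := by
      have hs : 0 < √((a : ℝ) + 1) := by positivity
      have e1 : √((a : ℝ) + 1) ^ 2 = a + 1 := Real.sq_sqrt (by positivity)
      have e2 : √(a : ℝ) ^ 2 = a := Real.sq_sqrt (by positivity)
      rw [div_le_iff₀ hs]
      have : 1 ≤ 2 * ((√((a : ℝ) + 1) - √(a : ℝ)) * √((a : ℝ) + 1)) := by
        nlinarith [sq_nonneg (√((a : ℝ) + 1) - √(a : ℝ))]
      nlinarith
    have h3 := h a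
    push_cast
    linarith

theorem abs_sub_le_sum_of_update {ι : Type*} [Fintype ι] [DecidableEq ι] {α : Type*}
    (g : (ι → α) → ℝ) (D : ι → α → α → ℝ)
    (h : ∀ x j a b, |g (Function.update x j a) - g (Function.update x j b)| ≤ D j a b)
    (x y : ι → α) : |g x - g y| ≤ ∑ j, D j (x j) (y j) := by
  have key : ∀ s : Finset ι, |g (s.piecewise x y) - g y| ≤ ∑ j ∈ s, D j (x j) (y j) := by
    intro s
    induction s using Finset.induction_on with
    | empty => simp
    | insert j s hj ih =>
      rw [Finset.sum_insert hj, Finset.piecewise_insert]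
      have h1 := h (s.piecewise x y) j (x j) (y j)
      have h2 : Function.update (s.piecewise x y) j (y j) = s.piecewise x y := by
        rw [Function.update_eq_self_iff, Finset.piecewise_eq_of_notMem _ _ _ hj]
      rw [h2] at h1
      exact (abs_sub_le _ _ _).trans (add_le_add h1 ih)
  simpa using key Finset.univ

theorem indepFun_of_measurable_iSup {Ω ι β γ : Type*} [MeasurableSpace Ω] {P : Measure Ω}
    {𝓧 : ι → Type*} [∀ i, MeasurableSpace (𝓧 i)] [MeasurableSpace β] [MeasurableSpace γ]
    {X : ∀ i, Ω → 𝓧 i} (hX : ∀ i, Measurable (X i)) (hind : iIndepFun X P) {s t : Set ι}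
    (hst : Disjoint s t) {f : Ω → β} {g : Ω → γ}
    (hf : Measurable[⨆ i ∈ s, MeasurableSpace.comap (X i) inferInstance] f)
    (hg : Measurable[⨆ i ∈ t, MeasurableSpace.comap (X i) inferInstance] g) : IndepFun f g P :=
  indep_of_indep_of_le (indep_iSup_of_disjoint (fun i => (hX i).comap_le) hind.iIndep hst)
    (measurable_iff_comap_le.1 hf) (measurable_iff_comap_le.1 hg)

theorem measurable_iSup_comap {Ω ι : Type*} {𝓧 : ι → Type*} [∀ i, MeasurableSpace (𝓧 i)]
    (X : ∀ i, Ω → 𝓧 i) {s : Set ι} {i : ι} (hi : i ∈ s) :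
    Measurable[⨆ i ∈ s, MeasurableSpace.comap (X i) inferInstance] (X i) :=
  measurable_iff_comap_le.2
    (le_iSup₂ (f := fun i (_ : i ∈ s) => MeasurableSpace.comap (X i) inferInstance) i hi)

variable {d : ℕ}

/-- A family of offspring laws: the law started from `x + y` is that of the sum of independent
copies started from `x` and `y`. -/
structure IsBranching (K : (Fin d → ℕ) → Measure (Fin d → ℕ)) : Prop where
  prob : ∀ x, IsProbabilityMeasure (K x)
  zero : K 0 = Measure.dirac 0
  add : ∀ x y, K (x + y) = K x ∗ K y

namespace IsBranching

variable {K K' : (Fin d → ℕ) → Measure (Fin d → ℕ)}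

theorem bind_conv (hK : IsBranching K) (μ ν : Measure (Fin d → ℕ)) [SFinite μ] [SFinite ν] :
    (μ ∗ ν).bind K = (μ.bind K) ∗ (ν.bind K) := by
  have := hK.prob
  have hKm : Measurable K := .of_discrete
  have : SFinite (ν.bind K) := by
    have : ν.bind K = (⟨K, hKm⟩ : Kernel (Fin d → ℕ) (Fin d → ℕ)) ∘ₘ ν := rfl
    have : IsMarkovKernel (⟨K, hKm⟩ : Kernel (Fin d → ℕ) (Fin d → ℕ)) := ⟨hK.prob⟩
    rw [‹ν.bind K = _›]; infer_instance
  refine Measure.ext_of_lintegral _ fun f hf => ?_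
  rw [Measure.lintegral_bind hKm.aemeasurable hf.aemeasurable,
    Measure.lintegral_conv .of_discrete, Measure.lintegral_conv hf,
    Measure.lintegral_bind hKm.aemeasurable (Measurable.of_discrete).aemeasurable]
  refine lintegral_congr fun x => ?_
  have h1 : ∀ u, ∫⁻ v, f (u + v) ∂(ν.bind K) = ∫⁻ y, ∫⁻ v, f (u + v) ∂(K y) ∂ν := fun u =>
    Measure.lintegral_bind hKm.aemeasurable (Measurable.of_discrete).aemeasurable
  simp_rw [h1]
  rw [lintegral_lintegral_swap (Measurable.of_discrete).aemeasurable]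
  refine lintegral_congr fun y => ?_
  rw [hK.add, Measure.lintegral_conv hf]

theorem isProbabilityMeasure_bind (hK : IsBranching K) (μ : Measure (Fin d → ℕ))
    [IsProbabilityMeasure μ] : IsProbabilityMeasure (μ.bind K) := by
  have := hK.prob
  constructor
  rw [Measure.bind_apply .univ (Measurable.of_discrete).aemeasurable]
  simp

theorem comp (hK : IsBranching K) (hK' : IsBranching K') :
    IsBranching fun x => (K' x).bind K where
  prob x := by
    have := hK'.prob x
    exact hK.isProbabilityMeasure_bind _
  zero := by rw [hK'.zero, Measure.dirac_bind .of_discrete, hK.zero]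
  add x y := by
    have := hK'.prob x
    have := hK'.prob y
    rw [hK'.add, hK.bind_conv]

theorem dirac : IsBranching (d := d) fun x => Measure.dirac x where
  prob x := inferInstance
  zero := rfl
  add x y := by simp

theorem apply_add_smul (hK : IsBranching K) (x e : Fin d → ℕ) (z : ℕ) :
    K (x + z • e) = K x ∗ (Measure.infinitePi fun _ : ℕ => K e).map (partialSum z) := by
  have := hK.prob
  induction z with
  | zero =>
    have h0 : partialSum (S := Fin d → ℕ) 0 = fun _ => 0 := by ext; simp [partialSum]
    simp [h0]
  | succ z ih =>
    have hind : iIndepFun (fun (l : ℕ) (ω : ℕ → Fin d → ℕ) => ω l)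
        (Measure.infinitePi fun _ : ℕ => K e) :=
      iIndepFun_infinitePi (X := fun _ x => x) (fun _ => measurable_id)
    have hS : partialSum (S := Fin d → ℕ) z =
        ∑ j ∈ Finset.range z, fun ω : ℕ → Fin d → ℕ => ω j := by
      ext ω : 1; simp [partialSum]
    have h2 : IndepFun (partialSum z) (fun ω : ℕ → Fin d → ℕ => ω z)
        (Measure.infinitePi fun _ : ℕ => K e) := by
      rw [hS]; exact hind.indepFun_sum_range_succ (fun i => measurable_pi_apply i) z
    have h3 : partialSum (S := Fin d → ℕ) (z + 1) = partialSum z + fun ω => ω z := by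
      ext ω : 1; simp [partialSum, Finset.sum_range_succ]
    have := Measure.isProbabilityMeasure_map (μ := Measure.infinitePi fun _ : ℕ => K e)
      (measurable_partialSum (S := Fin d → ℕ) z).aemeasurable
    rw [h3, h2.map_add_eq_map_conv_map (measurable_partialSum z) (measurable_pi_apply z),
      Measure.infinitePi_map_eval, ← Measure.conv_assoc, ← ih, ← hK.add, add_smul, one_smul,
      add_assoc]

/-- The total variation distance between the laws started from `x` and `y`, possibly blurred by
independent noise, is controlled by the distance of the square roots of `x` and `y`. -/
theorem abs_integral_conv_sub_le (hK : IsBranching K) (L : Measure (Fin d → ℕ))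
    [IsProbabilityMeasure L] {h : (Fin d → ℕ) → ℝ} (h1 : ∀ x, |h x| ≤ 1)
    (hq : ∀ j, (K (Pi.single j 1)).real {0}ᶜ ≤ 1 / 2) (x y : Fin d → ℕ) :
    |∫ z, h z ∂(K x ∗ L) - ∫ z, h z ∂(K y ∗ L)| ≤
      ∑ j, 2 * √(2 * (K (Pi.single j 1)).real {0}ᶜ) * |√(x j : ℝ) - √(y j : ℝ)| := by
  have := hK.prob
  have hint : ∀ (ν : Measure (Fin d → ℕ)) [IsFiniteMeasure ν] (f : (Fin d → ℕ) → ℝ),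
      (∀ x, |f x| ≤ 1) → Integrable f ν := fun ν _ f hf =>
    Integrable.of_bound (Measurable.of_discrete).aestronglyMeasurable 1 (ae_of_all _ hf)
  refine abs_sub_le_sum_of_update (fun x => ∫ z, h z ∂(K x ∗ L)) (fun j a b =>
    2 * √(2 * (K (Pi.single j 1)).real {0}ᶜ) * |√(a : ℝ) - √(b : ℝ)|) (fun x j a b => ?_) x y
  set e : Fin d → ℕ := Pi.single j 1
  have hup : ∀ z, Function.update x j z = Function.update x j 0 + z • e := fun z => by
    ext i
    by_cases hi : i = j
    · subst hi; simp [e]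
    · simp [e, hi]
  set ν := K (Function.update x j 0) ∗ L
  set f : (Fin d → ℕ) → ℝ := fun s => ∫ w, h (s + w) ∂ν with hf
  have hf1 : ∀ s, |f s| ≤ 1 := fun s => by
    have := norm_integral_le_of_norm_le_const (μ := ν) (f := fun w => h (s + w)) (C := 1)
      (ae_of_all _ fun w => h1 _)
    simpa using this
  have hG : ∀ z, ∫ w, h w ∂(K (Function.update x j z) ∗ L) =
      ∫ ω, f (partialSum z ω) ∂(Measure.infinitePi fun _ : ℕ => K e) := fun z => by
    have := Measure.isProbabilityMeasure_map (μ := Measure.infinitePi fun _ : ℕ => K e)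
      (measurable_partialSum (S := Fin d → ℕ) z).aemeasurable
    rw [hup z, hK.apply_add_smul, Measure.conv_comm (K _), Measure.conv_assoc,
      integral_conv (hint _ _ h1),
      integral_map (measurable_partialSum z).aemeasurable
        (Measurable.of_discrete).aestronglyMeasurable]
  simp only [hG]
  exact abs_sub_le_of_abs_succ_sub_le (G := fun z =>
    ∫ ω, f (partialSum z ω) ∂(Measure.infinitePi fun _ : ℕ => K e)) (Real.sqrt_nonneg _)
    (abs_integral_partialSum_succ_sub_le (K e) .of_discrete hf1 (hq j)) a b

end IsBranching

section Thinning

/-- The number of counts `x` that remain after thinning by means of the count variables `y`. -/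
def thin (x : Fin d → ℕ) (y : ℕ × Fin d × Fin d → ℕ) (i : Fin d) : ℕ :=
  ∑ j, ∑ s ∈ Finset.range (x j), y (s, i, j)

theorem measurable_thin (x : Fin d → ℕ) : Measurable (thin x) := by
  unfold thin; fun_prop

theorem measurable_thin_of {Ω : Type*} {_ : MeasurableSpace Ω} (x : Fin d → ℕ)
    {y : Ω → ℕ × Fin d × Fin d → ℕ}
    (h : ∀ s i j, s < x j → Measurable fun ω => y ω (s, i, j)) :
    Measurable fun ω => thin x (y ω) :=
  measurable_pi_iff.2 fun i => Finset.measurable_fun_sum _ fun j _ =>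
    Finset.measurable_fun_sum _ fun s hs => h s i j (Finset.mem_range.1 hs)

variable (B : Matrix (Fin d) (Fin d) ℝ) (hB : ∀ i j, B i j ∈ unitInterval)

/-- The joint law of the count variables of one time step. -/
noncomputable def countLaw : Measure (ℕ × Fin d × Fin d → ℕ) :=
  Measure.infinitePi fun p => bernoulliMeasure 1 0 ⟨B p.2.1 p.2.2, hB p.2.1 p.2.2⟩

instance : IsProbabilityMeasure (countLaw B hB) := by unfold countLaw; infer_instance

/-- The law of the thinned vector `B ∘ x`. -/
noncomputable def thinLaw (x : Fin d → ℕ) : Measure (Fin d → ℕ) := (countLaw B hB).map (thin x)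

theorem iIndepFun_countLaw :
    iIndepFun (fun (p : ℕ × Fin d × Fin d) (ω : ℕ × Fin d × Fin d → ℕ) => ω p) (countLaw B hB) :=
  iIndepFun_infinitePi (X := fun _ x => x) (fun _ => measurable_id)

theorem countLaw_map_eval (p : ℕ × Fin d × Fin d) :
    (countLaw B hB).map (fun ω => ω p) =
      bernoulliMeasure 1 0 ⟨B p.2.1 p.2.2, hB p.2.1 p.2.2⟩ :=
  Measure.infinitePi_map_eval (fun p : ℕ × Fin d × Fin d =>
    bernoulliMeasure (1 : ℕ) 0 ⟨B p.2.1 p.2.2, hB p.2.1 p.2.2⟩) p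

theorem isBranching_thinLaw : IsBranching (thinLaw B hB) where
  prob x := Measure.isProbabilityMeasure_map (measurable_thin x).aemeasurable
  zero := by
    have : thin (0 : Fin d → ℕ) = fun _ => 0 := by ext; simp [thin]
    simp [thinLaw, this]
  add x y := by
    set σ : ℕ × Fin d × Fin d → ℕ × Fin d × Fin d := fun p => (x p.2.2 + p.1, p.2)
    have hσ : Function.Injective σ := by
      rintro ⟨s, i, j⟩ ⟨s', i', j'⟩ h
      simp only [σ, Prod.mk.injEq] at h
      obtain ⟨h1, rfl, rfl⟩ := h
      simp_all
    have hmap : (countLaw B hB).map (fun ω p => ω (σ p)) = countLaw B hB :=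
      Measure.map_infinitePi_infinitePi_of_inj (P := fun p : ℕ × Fin d × Fin d =>
        bernoulliMeasure (1 : ℕ) 0 ⟨B p.2.1 p.2.2, hB p.2.1 p.2.2⟩) hσ
    have hσm : Measurable fun (ω : ℕ × Fin d × Fin d → ℕ) p => ω (σ p) := by fun_prop
    have hsplit : thin (x + y) = thin x + fun ω => thin y (fun p => ω (σ p)) := by
      ext ω i
      simp [thin, Finset.sum_range_add, Finset.sum_add_distrib, σ]
    have hind : IndepFun (thin x) (fun ω => thin y (fun p => ω (σ p))) (countLaw B hB) := by
      refine indepFun_of_measurable_iSup (fun p => measurable_pi_apply p)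
        (iIndepFun_countLaw B hB) (disjoint_compl_right (a := {p | p.1 < x p.2.2})) ?_ ?_
      · exact measurable_thin_of x fun s i j hs => measurable_iSup_comap
          (fun (p : ℕ × Fin d × Fin d) (ω : ℕ × Fin d × Fin d → ℕ) => ω p)
          (i := (s, i, j)) (by simpa using hs)
      · exact measurable_thin_of y fun s i j hs => measurable_iSup_comap
          (fun (p : ℕ × Fin d × Fin d) (ω : ℕ × Fin d × Fin d → ℕ) => ω p)
          (i := (x j + s, i, j)) (by simp)
    have h2 : (countLaw B hB).map (fun ω => thin y (fun p => ω (σ p))) = thinLaw B hB y := by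
      conv_rhs => rw [thinLaw, ← hmap]
      rw [Measure.map_map (measurable_thin y) hσm]
      rfl
    have hym : Measurable fun ω : ℕ × Fin d × Fin d → ℕ => thin y (fun p => ω (σ p)) := (measurable_thin y).comp hσm
    rw [thinLaw, hsplit, hind.map_add_eq_map_conv_map (measurable_thin x) hym, h2]
    rfl

theorem lintegral_thinLaw (x : Fin d → ℕ) (i : Fin d) :
    ∫⁻ z, (z i : ℝ≥0∞) ∂(thinLaw B hB x) = ∑ j, ENNReal.ofReal (B i j) * x j := by
  have h1 : ∀ p : ℕ × Fin d × Fin d,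
      ∫⁻ ω, (ω p : ℝ≥0∞) ∂(countLaw B hB) = ENNReal.ofReal (B p.2.1 p.2.2) := fun p => by
    have := lintegral_map (μ := countLaw B hB) (f := fun n : ℕ => (n : ℝ≥0∞))
      .of_discrete (measurable_pi_apply p)
    rw [← this, countLaw_map_eval, bernoulliMeasure_def, lintegral_add_measure,
      lintegral_smul_measure, lintegral_smul_measure, lintegral_dirac, lintegral_dirac]
    simp only [ENNReal.smul_def, smul_eq_mul, Nat.cast_one, mul_one, Nat.cast_zero, mul_zero,
      add_zero]
    exact (ENNReal.ofReal_eq_coe_nnreal (hB p.2.1 p.2.2).1).symm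
  rw [thinLaw, lintegral_map .of_discrete (measurable_thin x)]
  simp only [thin, Nat.cast_sum]
  rw [lintegral_finsetSum _ fun j _ => by fun_prop]
  refine Finset.sum_congr rfl fun j _ => ?_
  rw [lintegral_finsetSum _ fun j _ => by fun_prop]
  simp [h1, mul_comm]

/-- The law of the `n`-step descendants of `x`. -/
noncomputable def descendantLaw : ℕ → (Fin d → ℕ) → Measure (Fin d → ℕ)
  | 0, x => Measure.dirac x
  | n + 1, x => (descendantLaw n x).bind (thinLaw B hB)

theorem isBranching_descendantLaw : ∀ n, IsBranching (descendantLaw B hB n)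
  | 0 => IsBranching.dirac
  | n + 1 => (isBranching_thinLaw B hB).comp (isBranching_descendantLaw n)

theorem lintegral_descendantLaw (n : ℕ) (x : Fin d → ℕ) (i : Fin d) :
    ∫⁻ z, (z i : ℝ≥0∞) ∂(descendantLaw B hB n x) = ∑ j, ENNReal.ofReal ((B ^ n) i j) * x j := by
  induction n generalizing i with
  | zero =>
    rw [descendantLaw, lintegral_dirac, Finset.sum_eq_single i] <;> 
      simp +contextual [eq_comm]
  | succ n ih =>
    have hB0 : ∀ i j, 0 ≤ B i j := fun i j => (hB i j).1
    rw [descendantLaw, Measure.lintegral_bind (Measurable.of_discrete).aemeasurable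
      (Measurable.of_discrete).aemeasurable]
    simp only [lintegral_thinLaw]
    rw [lintegral_finsetSum _ fun _ _ => .of_discrete]
    simp_rw [lintegral_const_mul _ (Measurable.of_discrete), ih, Finset.mul_sum, pow_succ' B,
      Matrix.mul_apply]
    rw [Finset.sum_comm]
    refine Finset.sum_congr rfl fun j _ => ?_
    rw [ENNReal.ofReal_sum_of_nonneg fun l _ => mul_nonneg (hB0 i l) (pow_apply_nonneg hB0 n l j),
      Finset.sum_mul]
    refine Finset.sum_congr rfl fun l _ => ?_
    rw [ENNReal.ofReal_mul (hB0 i l), mul_assoc]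

/-- The probability that a single individual of type `j` has any `n`-step descendants. -/
theorem descendantLaw_single_real_le (n : ℕ) (j : Fin d) :
    (descendantLaw B hB n (Pi.single j 1)).real {0}ᶜ ≤ ∑ i, (B ^ n) i j := by
  have hB0 : ∀ i j, 0 ≤ B i j := fun i j => (hB i j).1
  have := (isBranching_descendantLaw B hB n).prob (Pi.single j 1)
  refine ENNReal.toReal_le_of_le_ofReal
    (Finset.sum_nonneg fun i _ => pow_apply_nonneg hB0 n i j) ?_
  calc descendantLaw B hB n (Pi.single j 1) {0}ᶜ
      = ∫⁻ z, ({0}ᶜ : Set (Fin d → ℕ)).indicator 1 z ∂(descendantLaw B hB n (Pi.single j 1)) :=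
        (lintegral_indicator_one (.of_discrete)).symm
    _ ≤ ∫⁻ z, ∑ i, (z i : ℝ≥0∞) ∂(descendantLaw B hB n (Pi.single j 1)) := by
        refine lintegral_mono fun z => ?_
        by_cases hz : z = 0
        · simp [hz]
        · obtain ⟨i, hi⟩ := Function.ne_iff.1 hz
          rw [Set.indicator_of_mem (by simpa using hz)]
          refine le_trans ?_ (Finset.single_le_sum (f := fun i => (z i : ℝ≥0∞))
            (fun _ _ => zero_le) (Finset.mem_univ i))
          simpa [Nat.one_le_iff_ne_zero] using hi
    _ = ENNReal.ofReal (∑ i, (B ^ n) i j) := by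
        rw [lintegral_finsetSum _ fun _ _ => .of_discrete,
          ENNReal.ofReal_sum_of_nonneg fun i _ => pow_apply_nonneg hB0 n i j]
        refine Finset.sum_congr rfl fun i _ => ?_
        rw [lintegral_descendantLaw, Finset.sum_eq_single j] <;> simp +contextual

end Thinning

section Independence

variable {Ω α β γ δ : Type*} [MeasurableSpace Ω] [MeasurableSpace α] [MeasurableSpace β]
  [MeasurableSpace γ] [MeasurableSpace δ] {P : Measure Ω} [IsProbabilityMeasure P]

theorem measurable_of_forall_apply {Ω ι : Type*} {𝓧 : ι → Type*} {_ : MeasurableSpace Ω}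
    [∀ i, MeasurableSpace (𝓧 i)] {f : Ω → ∀ i, 𝓧 i} (h : ∀ i, Measurable fun ω => f ω i) :
    Measurable f := measurable_pi_iff.2 h

theorem lintegral_indepFun {U : Ω → α} {V : Ω → β} (h : IndepFun U V P) (hU : Measurable U)
    (hV : Measurable V) {f : α × β → ℝ≥0∞} (hf : Measurable f) :
    ∫⁻ ω, f (U ω, V ω) ∂P = ∫⁻ u, ∫⁻ v, f (u, v) ∂(P.map V) ∂(P.map U) := by
  rw [← lintegral_map hf (hU.prodMk hV),
    h.map_prod_eq_prod_map_map hU.aemeasurable hV.aemeasurable,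
    lintegral_prod _ hf.aemeasurable]

theorem indepFun_prodMk_prodMk {U₁ : Ω → α} {U₂ : Ω → β} {V₁ : Ω → γ} {V₂ : Ω → δ}
    (hU₁ : Measurable U₁) (hU₂ : Measurable U₂) (hV₁ : Measurable V₁) (hV₂ : Measurable V₂)
    (hU : IndepFun U₁ U₂ P) (hV : IndepFun V₁ V₂ P)
    (hUV : IndepFun (fun ω => (U₁ ω, U₂ ω)) (fun ω => (V₁ ω, V₂ ω)) P) :
    IndepFun (fun ω => (U₁ ω, V₁ ω)) (fun ω => (U₂ ω, V₂ ω)) P := by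
  have h1 : IndepFun U₁ V₁ P := hUV.comp measurable_fst measurable_fst
  have h2 : IndepFun U₂ V₂ P := hUV.comp measurable_snd measurable_snd
  have := Measure.isProbabilityMeasure_map (μ := P) hU₁.aemeasurable
  have := Measure.isProbabilityMeasure_map (μ := P) hU₂.aemeasurable
  have := Measure.isProbabilityMeasure_map (μ := P) hV₁.aemeasurable
  have := Measure.isProbabilityMeasure_map (μ := P) hV₂.aemeasurable
  rw [indepFun_iff_map_prod_eq_prod_map_map (by fun_prop) (by fun_prop),
    h1.map_prod_eq_prod_map_map (by fun_prop) (by fun_prop),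
    h2.map_prod_eq_prod_map_map (by fun_prop) (by fun_prop)]
  refine Measure.ext_of_lintegral _ fun f hf => ?_
  have h3 := lintegral_indepFun hUV (by fun_prop) (by fun_prop)
    (f := fun p => f ((p.1.1, p.2.1), (p.1.2, p.2.2))) (by fun_prop)
  rw [lintegral_map hf (by fun_prop), h3,
    hU.map_prod_eq_prod_map_map (by fun_prop) (by fun_prop),
    hV.map_prod_eq_prod_map_map (by fun_prop) (by fun_prop),
    lintegral_prod _ (by fun_prop), lintegral_prod _ (by fun_prop),
    lintegral_prod _ (by fun_prop)]
  refine lintegral_congr fun a => ?_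
  have e1 : ∀ b, ∫⁻ p, f ((a, p.1), (b, p.2)) ∂((P.map V₁).prod (P.map V₂)) =
      ∫⁻ c, ∫⁻ d, f ((a, c), (b, d)) ∂(P.map V₂) ∂(P.map V₁) := fun b =>
    lintegral_prod _ (by fun_prop)
  have e2 : ∀ c, ∫⁻ p, f ((a, c), p) ∂((P.map U₂).prod (P.map V₂)) =
      ∫⁻ b, ∫⁻ d, f ((a, c), (b, d)) ∂(P.map V₂) ∂(P.map U₂) := fun c =>
    lintegral_prod _ (by fun_prop)
  simp only [e1, e2]
  refine lintegral_lintegral_swap (Measurable.aemeasurable ?_)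
  exact Measurable.lintegral_prod_right' (f := fun q : (β × γ) × δ => f ((a, q.1.2), (q.1.1, q.2)))
    (by fun_prop)

theorem measureReal_indepFun {U : Ω → α} {V : Ω → β} (h : IndepFun U V P) (hU : Measurable U)
    (hV : Measurable V) {D : Set (α × β)} (hD : MeasurableSet D) :
    P.real {ω | (U ω, V ω) ∈ D} = ∫ u, P.real {ω | (u, V ω) ∈ D} ∂(P.map U) := by
  have := Measure.isProbabilityMeasure_map (μ := P) hV.aemeasurable
  have h1 : ∀ u, P {ω | (u, V ω) ∈ D} = P.map V (Prod.mk u ⁻¹' D) := fun u =>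
    (Measure.map_apply hV (measurable_prodMk_left hD)).symm
  simp only [measureReal_def, h1]
  rw [integral_toReal (measurable_measure_prodMk_left hD).aemeasurable
    (ae_of_all _ fun u => measure_lt_top _ _), ← Measure.prod_apply hD,
    ← h.map_prod_eq_prod_map_map hU.aemeasurable hV.aemeasurable,
    Measure.map_apply (hU.prodMk hV) hD]
  rfl

theorem measurable_measureReal_section {V : Ω → β} (hV : Measurable V) {D : Set (α × β)}
    (hD : MeasurableSet D) : Measurable fun u => P.real {ω | (u, V ω) ∈ D} := by
  have h1 : ∀ u, P {ω | (u, V ω) ∈ D} = P.map V (Prod.mk u ⁻¹' D) := fun u =>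
    (Measure.map_apply hV (measurable_prodMk_left hD)).symm
  simp only [measureReal_def, h1]
  have := Measure.isProbabilityMeasure_map (μ := P) hV.aemeasurable
  exact (measurable_measure_prodMk_left hD).ennreal_toReal

/-- The conditional probability of an event described by two independent random elements, given
the first one. -/
theorem condExp_indepFun {U : Ω → α} {V : Ω → β} (h : IndepFun U V P) (hU : Measurable U)
    (hV : Measurable V) {D : Set (α × β)} (hD : MeasurableSet D) :
    P⟦{ω | (U ω, V ω) ∈ D} | MeasurableSpace.comap U inferInstance⟧ =ᵐ[P]
      fun ω => P.real {ω' | (U ω, V ω') ∈ D} := by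
  have hg := measurable_measureReal_section (P := P) hV hD
  have hDm : MeasurableSet {ω | (U ω, V ω) ∈ D} := (hU.prodMk hV) hD
  have hgi : Integrable (fun ω => P.real {ω' | (U ω, V ω') ∈ D}) P :=
    Integrable.of_bound (hg.comp hU).aestronglyMeasurable 1 (ae_of_all _ fun ω => by
      rw [Real.norm_of_nonneg measureReal_nonneg]; exact measureReal_le_one)
  refine (ae_eq_condExp_of_forall_setIntegral_eq hU.comap_le ?_ (fun _ _ _ => hgi.integrableOn)
    ?_ ?_).symm
  · exact (integrable_const (1 : ℝ)).indicator hDm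
  · rintro _ ⟨E, hE, rfl⟩ -
    have hDE : MeasurableSet (D ∩ (Prod.fst ⁻¹' E)) := hD.inter (measurable_fst hE)
    have h1 := measureReal_indepFun h hU hV hDE
    rw [← setIntegral_map hE hg.aestronglyMeasurable hU.aemeasurable, ← integral_indicator hE]
    have h2 : ∫ ω in U ⁻¹' E, {ω | (U ω, V ω) ∈ D}.indicator (fun _ => (1 : ℝ)) ω ∂P =
        P.real {ω | (U ω, V ω) ∈ D ∩ (Prod.fst ⁻¹' E)} := by
      rw [integral_indicator hDm, setIntegral_const, smul_eq_mul, mul_one,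
        measureReal_restrict_apply hDm]
      rfl
    rw [h2, h1]
    refine integral_congr_ae (ae_of_all _ fun u => ?_)
    by_cases hu : u ∈ E <;> simp [hu]
  · exact (hg.comp (comap_measurable U)).stronglyMeasurable.aestronglyMeasurable

end Independence

section Trajectories

variable {d : ℕ}

/-- The count variables and the covariate of one time step. -/
abbrev Noise (d : ℕ) : Type := (ℕ × Fin d × Fin d → ℕ) × (Fin d → ℕ)

/-- One step of the model equation. -/
def step (x : Fin d → ℕ) (w : Noise d) : Fin d → ℕ := thin x w.1 + w.2

/-- The path that starts at `x` and is driven by the noise sequence `w`. -/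
def traj (x : Fin d → ℕ) (w : ℕ → Noise d) : ℕ → Fin d → ℕ
  | 0 => x
  | m + 1 => step (traj x w m) (w m)

theorem measurable_step : Measurable fun p : (Fin d → ℕ) × Noise d => step p.1 p.2 :=
  measurable_from_prod_countable_right fun x =>
    ((measurable_thin x).comp measurable_fst).add measurable_snd

theorem measurable_step_comp {Ω : Type*} [MeasurableSpace Ω] {U : Ω → Fin d → ℕ}
    {W : Ω → Noise d} (hU : Measurable U) (hW : Measurable W) :
    Measurable fun ω => step (U ω) (W ω) := by
  have h : Measurable fun ω => (U ω, W ω) := hU.prodMk hW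
  intro s hs
  exact h (measurable_step hs)

theorem measurable_traj {Ω : Type*} [MeasurableSpace Ω] {U : Ω → Fin d → ℕ}
    {W : Ω → ℕ → Noise d} (hU : Measurable U) (hW : Measurable W) (m : ℕ) :
    Measurable fun ω => traj (U ω) (W ω) m := by
  induction m with
  | zero => exact hU
  | succ m ih => exact measurable_step_comp ih ((measurable_pi_apply m).comp hW)

theorem traj_add (x : Fin d → ℕ) (w : ℕ → Noise d) (n m : ℕ) :
    traj x w (n + m) = traj (traj x w n) (fun l => w (n + l)) m := by
  induction m with
  | zero => rfl
  | succ m ih => rw [← add_assoc, traj, traj, ih]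

theorem traj_congr (x : Fin d → ℕ) {w w' : ℕ → Noise d} {m : ℕ} (h : ∀ l < m, w l = w' l) :
    traj x w m = traj x w' m := by
  induction m with
  | zero => rfl
  | succ m ih => rw [traj, traj, ih fun l hl => h l (by omega), h m (by omega)]

/-- Extends a finite piece of a noise sequence by zero. -/
def extendNoise {t : ℕ} (w : Set.Iio t → Noise d) (m : ℕ) : Noise d :=
  if h : m < t then w ⟨m, h⟩ else 0

theorem measurable_extendNoise {t : ℕ} : Measurable (extendNoise (d := d) (t := t)) := by
  refine measurable_pi_iff.2 fun m => ?_
  by_cases h : m < t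
  · simp only [extendNoise, h, dif_pos]; exact measurable_pi_apply _
  · simp only [extendNoise, h, dif_neg, not_false_eq_true]; exact measurable_const

/-- The count variables and the covariate of time step `t + 1`. -/
def noise {Ω : Type*} (Z : ℕ → Ω → Fin d → ℕ) (Y : ℕ → ℕ → Fin d → Fin d → Ω → ℕ)
    (t : ℕ) (ω : Ω) : Noise d :=
  (fun p => Y (t + 1) (p.1 + 1) p.2.1 p.2.2 ω, Z (t + 1) ω)

/-- The noise that drives the process from time `t` on. -/
def noiseFrom {Ω : Type*} (Z : ℕ → Ω → Fin d → ℕ) (Y : ℕ → ℕ → Fin d → Fin d → Ω → ℕ)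
    (t : ℕ) (ω : Ω) (m : ℕ) : Noise d := noise Z Y (t + m) ω

end Trajectories

namespace IsGINAR

variable {Ω : Type*} [MeasurableSpace Ω] {μ : Measure Ω}
  {d : ℕ} {B : Matrix (Fin d) (Fin d) ℝ} {X Z : ℕ → Ω → Fin d → ℕ}
  {Y : ℕ → ℕ → Fin d → Fin d → Ω → ℕ}

theorem measurable_noise (hX : IsGINAR μ B X Z Y) (t : ℕ) : Measurable (noise Z Y t) :=
  (measurable_of_forall_apply (f := fun ω (p : ℕ × Fin d × Fin d) =>
    Y (t + 1) (p.1 + 1) p.2.1 p.2.2 ω) fun p => hX.measurable_Y t p.1 p.2.1 p.2.2).prodMk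
    (hX.measurable_Z t)

theorem measurable_noiseFrom (hX : IsGINAR μ B X Z Y) (t : ℕ) : Measurable (noiseFrom Z Y t) :=
  measurable_pi_iff.2 fun m => hX.measurable_noise (t + m)

theorem map_counts (hX : IsGINAR μ B X Z Y) (t : ℕ) :
    μ.map (fun ω => (noise Z Y t ω).1) = countLaw B hX.mem_unitInterval := by
  have h : iIndepFun (fun p : ℕ × Fin d × Fin d => Y (t + 1) (p.1 + 1) p.2.1 p.2.2) μ :=
    hX.indep_Y.precomp (g := fun p : ℕ × Fin d × Fin d => (t, p)) (Prod.mk_right_injective t)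
  have h1 := h.map_fun_eq_infinitePi_map
    fun p : ℕ × Fin d × Fin d => hX.measurable_Y t p.1 p.2.1 p.2.2
  simp only [(hX.law_Y t _ _ _).map_eq] at h1
  exact h1

theorem ae_eq_traj (hX : IsGINAR μ B X Z Y) (k : ℕ) :
    ∀ᵐ ω ∂μ, ∀ m, X (k + m) ω = traj (X k ω) (noiseFrom Z Y k ω) m := by
  have h : ∀ᵐ ω ∂μ, ∀ t i, X (t + 1) ω i =
      (∑ j, ∑ s ∈ Finset.range (X t ω j), Y (t + 1) (s + 1) i j ω) + Z (t + 1) ω i :=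
    ae_all_iff.2 hX.model
  filter_upwards [h] with ω hω m
  induction m with
  | zero => rfl
  | succ m ih =>
    rw [traj, ← ih]
    ext i
    exact hω (k + m) i

variable [IsProbabilityMeasure μ]

/-- The initial value and the noise before time `t` are independent of the noise from `t` on. -/
theorem indepFun_noiseFrom (hX : IsGINAR μ B X Z Y) (t : ℕ) :
    IndepFun (fun ω => (X 0 ω, fun m : Set.Iio t => noise Z Y m ω)) (noiseFrom Z Y t) μ := by
  have hYm : ∀ p : ℕ × ℕ × Fin d × Fin d,
      Measurable (Y (p.1 + 1) (p.2.1 + 1) p.2.2.1 p.2.2.2) := fun p => hX.measurable_Y _ _ _ _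
  have hZm := hX.measurable_Z
  have hX0 := hX.measurable_X 0
  set Zb : Ω → Set.Iio t → Fin d → ℕ := fun ω m => Z (m + 1) ω
  set Zf : Ω → ℕ → Fin d → ℕ := fun ω m => Z (t + m + 1) ω
  set Yb : Ω → Set.Iio t × ℕ × Fin d × Fin d → ℕ :=
    fun ω p => Y (p.1 + 1) (p.2.1 + 1) p.2.2.1 p.2.2.2 ω
  set Yf : Ω → ℕ × ℕ × Fin d × Fin d → ℕ :=
    fun ω p => Y (t + p.1 + 1) (p.2.1 + 1) p.2.2.1 p.2.2.2 ω
  have hZb : Measurable Zb := measurable_pi_iff.2 fun m => hZm m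
  have hZf : Measurable Zf := measurable_pi_iff.2 fun m => hZm (t + m)
  have hYb : Measurable Yb := measurable_pi_iff.2 fun p => hX.measurable_Y p.1 _ _ _
  have hYf : Measurable Yf := measurable_pi_iff.2 fun p => hX.measurable_Y (t + p.1) _ _ _
  have hZ : IndepFun Zb Zf μ := by
    refine indepFun_of_measurable_iSup (X := fun t : ℕ => Z (t + 1)) hZm hX.indep_Z
      (disjoint_compl_right (a := Set.Iio t)) (measurable_of_forall_apply fun m => ?_)
      (measurable_of_forall_apply fun m => ?_)
    · exact measurable_iSup_comap (fun t : ℕ => Z (t + 1)) (s := Set.Iio t) m.2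
    · exact measurable_iSup_comap (fun t : ℕ => Z (t + 1)) (i := t + m) (by simp)
  have hY : IndepFun Yb Yf μ := by
    refine indepFun_of_measurable_iSup (X := fun p : ℕ × ℕ × Fin d × Fin d =>
      Y (p.1 + 1) (p.2.1 + 1) p.2.2.1 p.2.2.2) hYm hX.indep_Y
      (disjoint_compl_right (a := {p | p.1 < t})) (measurable_of_forall_apply fun p => ?_)
      (measurable_of_forall_apply fun p => ?_)
    · exact measurable_iSup_comap (fun p : ℕ × ℕ × Fin d × Fin d =>
        Y (p.1 + 1) (p.2.1 + 1) p.2.2.1 p.2.2.2) (s := {p | p.1 < t}) (i := (p.1, p.2)) p.1.2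
    · exact measurable_iSup_comap (fun p : ℕ × ℕ × Fin d × Fin d =>
        Y (p.1 + 1) (p.2.1 + 1) p.2.2.1 p.2.2.2) (i := (t + p.1, p.2)) (by simp)
  have hZY : IndepFun (fun ω => (Zb ω, Zf ω)) (fun ω => (Yb ω, Yf ω)) μ :=
    hX.indep_Z_Y.comp
      (φ := fun z : ℕ → Fin d → ℕ => ((fun m : Set.Iio t => z m), fun m => z (t + m)))
      (ψ := fun y : ℕ × ℕ × Fin d × Fin d → ℕ => ((fun p : Set.Iio t × ℕ × Fin d × Fin d => y (p.1, p.2)),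
        fun p : ℕ × ℕ × Fin d × Fin d => y (t + p.1, p.2))) (by fun_prop) (by fun_prop)
  have hbf := indepFun_prodMk_prodMk hZb hZf hYb hYf hZ hY hZY
  have h0 : IndepFun (fun ω => (X 0 ω, ())) (fun ω => ((Zb ω, Yb ω), (Zf ω, Yf ω))) μ :=
    hX.indep_X_zero.comp (φ := fun x : Fin d → ℕ => (x, ()))
      (ψ := fun q : (ℕ → Fin d → ℕ) × (ℕ × ℕ × Fin d × Fin d → ℕ) => (((fun m : Set.Iio t => q.1 m),
          (fun p : Set.Iio t × ℕ × Fin d × Fin d => q.2 (p.1, p.2))),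
        ((fun m => q.1 (t + m)), fun p : ℕ × ℕ × Fin d × Fin d => q.2 (t + p.1, p.2))))
      (by fun_prop) (by fun_prop)
  have h1 := indepFun_prodMk_prodMk hX0 measurable_const (hZb.prodMk hYb) (hZf.prodMk hYf)
    (indepFun_const_right _ _) hbf h0
  exact h1.comp
    (φ := fun q : (Fin d → ℕ) × (Set.Iio t → Fin d → ℕ) × (Set.Iio t × ℕ × Fin d × Fin d → ℕ) =>
      (q.1, fun m : Set.Iio t => ((fun p => q.2.2 (m, p), q.2.1 m) : Noise d)))
    (ψ := fun (q : Unit × (ℕ → Fin d → ℕ) × (ℕ × ℕ × Fin d × Fin d → ℕ)) (m : ℕ) =>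
      ((fun p => q.2.2 (m, p), q.2.1 m) : Noise d))
    (by fun_prop) (by fun_prop)

/-- The past up to time `t` is independent of the noise from `t` on. -/
theorem indepFun_past_noiseFrom (hX : IsGINAR μ B X Z Y) (t : ℕ) :
    IndepFun (fun ω (j : Set.Iic t) => X j ω) (noiseFrom Z Y t) μ := by
  have h := (hX.indepFun_noiseFrom t).comp
    (φ := fun (q : (Fin d → ℕ) × (Set.Iio t → Noise d)) (j : Set.Iic t) =>
      traj q.1 (extendNoise q.2) j) (ψ := id)
    (measurable_of_forall_apply fun j => measurable_traj measurable_fst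
      (measurable_extendNoise.comp measurable_snd) j) measurable_id
  refine h.congr ?_ .rfl
  filter_upwards [hX.ae_eq_traj 0] with ω hω
  ext1 j
  have := hω j
  rw [zero_add] at this
  rw [this]
  refine traj_congr _ fun l hl => ?_
  have hlt : l < t := lt_of_lt_of_le hl j.2
  simp [extendNoise, hlt, noiseFrom]

theorem indepFun_traj_noiseFrom (hX : IsGINAR μ B X Z Y) (x : Fin d → ℕ) (k n : ℕ) :
    IndepFun (fun ω => traj x (noiseFrom Z Y k ω) n) (noiseFrom Z Y (k + n)) μ := by
  have h := (hX.indepFun_noiseFrom (k + n)).comp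
    (φ := fun q : (Fin d → ℕ) × (Set.Iio (k + n) → Noise d) =>
      traj x (fun m => extendNoise q.2 (k + m)) n) (ψ := id)
    (measurable_traj measurable_const (measurable_of_forall_apply fun m =>
      (measurable_pi_apply (k + m)).comp (measurable_extendNoise.comp measurable_snd)) n)
    measurable_id
  refine h.congr (ae_of_all _ fun ω => ?_) .rfl
  refine Eq.symm ?_
  refine traj_congr _ fun l hl => ?_
  simp [extendNoise, hl, noiseFrom]

/-- The law of one step of the model, started from a state that is independent of the noise. -/
theorem map_step (hX : IsGINAR μ B X Z Y) (t : ℕ) {U : Ω → Fin d → ℕ} (hU : Measurable U)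
    (h : IndepFun U (noise Z Y t) μ) :
    μ.map (fun ω => step (U ω) (noise Z Y t ω)) =
      ((μ.map U).bind (thinLaw B hX.mem_unitInterval)) ∗ μ.map (Z (t + 1)) := by
  have hN := hX.measurable_noise t
  have := Measure.isProbabilityMeasure_map (μ := μ) (hX.measurable_Z t).aemeasurable
  have hYZ : IndepFun (fun ω => (noise Z Y t ω).1) (Z (t + 1)) μ :=
    hX.indep_Z_Y.symm.comp
      (φ := fun (y : ℕ × ℕ × Fin d × Fin d → ℕ) (p : ℕ × Fin d × Fin d) => y (t, p))
      (ψ := fun z : ℕ → Fin d → ℕ => z t)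
      (by fun_prop) (by fun_prop)
  have hlaw : μ.map (noise Z Y t) =
      (countLaw B hX.mem_unitInterval).prod (μ.map (Z (t + 1))) := by
    rw [← hX.map_counts t, ← hYZ.map_prod_eq_prod_map_map
      hN.fst.aemeasurable (hX.measurable_Z t).aemeasurable]
    rfl
  refine Measure.ext_of_lintegral _ fun f hf => ?_
  have hfs : Measurable fun p : (Fin d → ℕ) × Noise d => f (step p.1 p.2) :=
    fun s hs => measurable_step (hf hs)
  rw [lintegral_map hf (measurable_step_comp hU hN),
    lintegral_indepFun h hU hN hfs, hlaw,
    Measure.lintegral_conv hf, Measure.lintegral_bind (Measurable.of_discrete).aemeasurable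
      (Measurable.of_discrete).aemeasurable]
  refine lintegral_congr fun u => ?_
  have hu : Measurable fun w : Noise d => f (step u w) := fun s hs =>
    measurable_prodMk_left (hfs hs)
  have h1 : ∫⁻ w, f (step u w) ∂((countLaw B hX.mem_unitInterval).prod (μ.map (Z (t + 1)))) =
      ∫⁻ y, ∫⁻ z, f (thin u y + z) ∂(μ.map (Z (t + 1))) ∂(countLaw B hX.mem_unitInterval) :=
    lintegral_prod _ hu.aemeasurable
  rw [h1, thinLaw, lintegral_map .of_discrete (measurable_thin u)]

/-- After `n` steps, a path consists of the descendants of its starting point and of an independent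
contribution of the covariates. -/
theorem exists_map_traj (hX : IsGINAR μ B X Z Y) (k n : ℕ) :
    ∃ L : Measure (Fin d → ℕ), IsProbabilityMeasure L ∧ ∀ x,
      μ.map (fun ω => traj x (noiseFrom Z Y k ω) n) =
        descendantLaw B hX.mem_unitInterval n x ∗ L := by
  induction n with
  | zero =>
    refine ⟨Measure.dirac 0, inferInstance, fun x => ?_⟩
    simp [traj, descendantLaw]
  | succ n ih =>
    obtain ⟨L, hL, h⟩ := ih
    have hbr := isBranching_thinLaw B hX.mem_unitInterval
    have := hbr.isProbabilityMeasure_bind L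
    have := Measure.isProbabilityMeasure_map (μ := μ) (hX.measurable_Z (k + n)).aemeasurable
    refine ⟨(L.bind (thinLaw B hX.mem_unitInterval)) ∗ μ.map (Z (k + n + 1)), inferInstance,
      fun x => ?_⟩
    have := ((isBranching_descendantLaw B hX.mem_unitInterval n).prob x)
    have := hbr.isProbabilityMeasure_bind (descendantLaw B hX.mem_unitInterval n x)
    have hm : Measurable fun ω => traj x (noiseFrom Z Y k ω) n :=
      measurable_traj measurable_const (hX.measurable_noiseFrom k) n
    have hi : IndepFun (fun ω => traj x (noiseFrom Z Y k ω) n) (noise Z Y (k + n)) μ :=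
      (hX.indepFun_traj_noiseFrom x k n).comp (φ := id) (ψ := fun w : ℕ → Noise d => w 0) measurable_id
        (measurable_pi_apply 0)
    have h2 := hX.map_step (k + n) hm hi
    rw [h x, hbr.bind_conv, Measure.conv_assoc] at h2
    exact h2

end IsGINAR

section Mixing

/-- Bound of the mixing coefficient when the first σ-algebra is generated by a random element with
countably many values. -/
theorem betaCoeff_comap_le {Ω τ : Type*} (m₂ : MeasurableSpace Ω) [MeasurableSpace Ω]
    {μ : Measure Ω} [MeasurableSpace τ] [Countable τ]
    [MeasurableSingletonClass τ] {T : Ω → τ}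
    (b : τ → ℝ≥0∞)
    (h : ∀ C, MeasurableSet[m₂] C → ∃ φ : τ → ℝ,
      (μ⟦C | MeasurableSpace.comap T inferInstance⟧ =ᵐ[μ] fun ω => φ (T ω)) ∧
      ∀ t, ENNReal.ofReal |φ t - μ.real C| ≤ b t) :
    betaCoeff μ (MeasurableSpace.comap T inferInstance) m₂ ≤ ∫⁻ ω, b (T ω) ∂μ := by
  have hnull : ∀ᵐ ω ∂μ, μ (T ⁻¹' {T ω}) ≠ 0 := by
    have : μ (⋃ t ∈ {t | μ (T ⁻¹' {t}) = 0}, T ⁻¹' {t}) = 0 :=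
      (measure_biUnion_null_iff (Set.to_countable _)).2 fun t ht => ht
    refine measure_mono_null (fun ω hω => ?_) this
    simpa using hω
  refine lintegral_mono_ae ?_
  filter_upwards [hnull] with ω hω
  refine iSup₂_le fun C hC => ?_
  obtain ⟨φ, hφ, hb⟩ := h C hC
  suffices (μ⟦C | MeasurableSpace.comap T inferInstance⟧) ω = φ (T ω) by
    rw [this]; exact hb _
  by_contra hne
  have hmeas : MeasurableSet[MeasurableSpace.comap T inferInstance]
      {ω | (μ⟦C | MeasurableSpace.comap T inferInstance⟧) ω = φ (T ω)}ᶜ :=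
    (measurableSet_eq_fun
      stronglyMeasurable_condExp.measurable
      ((Measurable.of_discrete (f := φ)).comp (comap_measurable T))).compl
  obtain ⟨E, -, hE⟩ := hmeas
  have hsub : T ⁻¹' {T ω} ⊆ {ω | (μ⟦C | MeasurableSpace.comap T inferInstance⟧) ω = φ (T ω)}ᶜ := by
    rw [← hE]
    have : ω ∈ T ⁻¹' E := by rw [hE]; exact hne
    intro ω' hω'
    rw [Set.mem_preimage, Set.mem_singleton_iff] at hω'
    rwa [Set.mem_preimage, hω']
  exact hω (measure_mono_null hsub hφ)

theorem past_eq_comap {Ω S : Type*} [MeasurableSpace S] (X : ℕ → Ω → S) (k : ℕ) :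
    past X k = MeasurableSpace.comap (fun ω (j : Set.Iic k) => X j ω) inferInstance := by
  simp only [past, MeasurableSpace.pi, MeasurableSpace.comap_iSup, MeasurableSpace.comap_comp,
    iSup_subtype']
  rfl

theorem exists_of_measurableSet_future {Ω S : Type*} [MeasurableSpace S] (X : ℕ → Ω → S) (m : ℕ)
    {C : Set Ω} (hC : MeasurableSet[future X m] C) :
    ∃ A : Set (ℕ → S), MeasurableSet A ∧ C = {ω | (fun l => X (m + l) ω) ∈ A} := by
  have hle : future X m ≤ MeasurableSpace.comap (fun ω l => X (m + l) ω) inferInstance := by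
    refine iSup₂_le fun j hj => ?_
    obtain ⟨l, rfl⟩ := Nat.exists_eq_add_of_le hj
    exact measurable_iff_comap_le.1 ((measurable_pi_apply l).comp
      (comap_measurable fun ω l => X (m + l) ω))
  obtain ⟨A, hA, rfl⟩ := hle C hC
  exact ⟨A, hA, rfl⟩

end Mixing

section SquareRoots

theorem abs_sqrt_add_sub_sqrt_add_le {a b a' b' : ℝ} (ha : 0 ≤ a) (hb : 0 ≤ b) (ha' : 0 ≤ a')
    (hb' : 0 ≤ b') : |√(a + b) - √(a' + b')| ≤ |√a - √a'| + |√b - √b'| := by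
  have h1 : ∀ {x y : ℝ}, 0 ≤ x → 0 ≤ y → √(x + y) = ‖(⟨√x, √y⟩ : ℂ)‖ := fun {x y} hx hy => by
    rw [Complex.norm_def, Complex.normSq_mk, Real.mul_self_sqrt hx, Real.mul_self_sqrt hy]
  rw [h1 ha hb, h1 ha' hb']
  refine (abs_norm_sub_norm_le _ _).trans ((Complex.norm_le_abs_re_add_abs_im _).trans ?_)
  simp

theorem abs_sqrt_sum_sub_sqrt_sum_le {ι : Type*} (s : Finset ι) {u v : ι → ℝ} (hu : ∀ i, 0 ≤ u i)
    (hv : ∀ i, 0 ≤ v i) :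
    |√(∑ i ∈ s, u i) - √(∑ i ∈ s, v i)| ≤ ∑ i ∈ s, |√(u i) - √(v i)| := by
  classical
  induction s using Finset.induction_on with
  | empty => simp
  | insert a s ha ih =>
    rw [Finset.sum_insert ha, Finset.sum_insert ha, Finset.sum_insert ha]
    exact (abs_sqrt_add_sub_sqrt_add_le (hu a) (Finset.sum_nonneg fun i _ => hu i) (hv a)
      (Finset.sum_nonneg fun i _ => hv i)).trans (by gcongr)

theorem abs_sqrt_sub_sqrt_mul_sqrt_le {a b : ℝ} (ha : 0 ≤ a) (hb : 0 ≤ b) :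
    |√a - √b| * √b ≤ |a - b| := by
  have h : a - b = (√a - √b) * (√a + √b) := by
    nlinarith [Real.sq_sqrt ha, Real.sq_sqrt hb]
  rw [h, abs_mul]
  exact mul_le_mul_of_nonneg_left ((le_add_of_nonneg_left (Real.sqrt_nonneg _)).trans
    (le_abs_self _)) (abs_nonneg _)

theorem sqrt_natCast_le_self (n : ℕ) : √(n : ℝ) ≤ n := by
  rw [Real.sqrt_le_left (Nat.cast_nonneg n)]
  exact_mod_cast Nat.le_self_pow two_ne_zero n

end SquareRoots

section Deviation

variable {d : ℕ} (B : Matrix (Fin d) (Fin d) ℝ) (hB : ∀ i j, B i j ∈ unitInterval)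

theorem ae_countLaw_eq_zero_or_one (p : ℕ × Fin d × Fin d) :
    ∀ᵐ y ∂(countLaw B hB), (y p : ℝ) = 0 ∨ (y p : ℝ) = 1 := by
  have h : ∀ᵐ n : ℕ ∂((countLaw B hB).map fun y => y p), (n : ℝ) = 0 ∨ (n : ℝ) = 1 := by
    rw [countLaw_map_eval, bernoulliMeasure_def, ae_add_measure_iff]
    constructor
    · exact Measure.ae_smul_measure (by simp [ae_dirac_eq]) _
    · exact Measure.ae_smul_measure (by simp [ae_dirac_eq]) _
  exact ae_of_ae_map (measurable_pi_apply p).aemeasurable h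

theorem integral_countLaw (p : ℕ × Fin d × Fin d) :
    ∫ y, (y p : ℝ) ∂(countLaw B hB) = B p.2.1 p.2.2 := by
  have := integral_map (μ := countLaw B hB) (f := fun n : ℕ => (n : ℝ))
    (measurable_pi_apply p).aemeasurable (Measurable.of_discrete).aestronglyMeasurable
  rw [← this, countLaw_map_eval, integral_bernoulliMeasure]
  simp

/-- The square root of a binomial variable with `n` trials differs from the square root of its mean
by at most `1` in the mean. -/
theorem lintegral_abs_sqrt_sum_sub_le (n : ℕ) (i j : Fin d) :
    ∫⁻ y, ENNReal.ofReal |√((∑ s ∈ Finset.range n, y (s, i, j) : ℕ) : ℝ) - √(B i j) * √(n : ℝ)|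
      ∂(countLaw B hB) ≤ 1 := by
  set P := countLaw B hB
  set p := B i j with hp
  have hp0 : 0 ≤ p := (hB i j).1
  have hp1 : p ≤ 1 := (hB i j).2
  set S : (ℕ × Fin d × Fin d → ℕ) → ℕ := fun y => ∑ s ∈ Finset.range n, y (s, i, j)
  have hSm : Measurable S := by fun_prop
  have hdev := integral_abs_sum_sub_le (P := P) (fun s y => (y (s, i, j) : ℝ)) (Finset.range n) p
    (fun s => by fun_prop) (fun s => ae_countLaw_eq_zero_or_one B hB (s, i, j))
    (fun s => integral_countLaw B hB (s, i, j))
    (((iIndepFun_countLaw B hB).precomp (g := fun s : ℕ => (s, i, j))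
      (Prod.mk_left_injective (i, j))).comp (fun _ n => (n : ℝ)) fun _ => .of_discrete)
  have hcast : ∀ y, ∑ s ∈ Finset.range n, (y (s, i, j) : ℝ) = S y := fun y => by simp [S]
  simp only [hcast, Finset.card_range] at hdev
  have hSi : Integrable (fun y => (S y : ℝ)) P := by
    simp only [← hcast]
    refine integrable_finsetSum _ fun s _ => Integrable.of_bound (C := 1)
      ((Measurable.of_discrete (f := fun n : ℕ => (n : ℝ))).comp
        (measurable_pi_apply _)).aestronglyMeasurable ?_
    filter_upwards [ae_countLaw_eq_zero_or_one B hB (s, i, j)] with y hy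
    rcases hy with hy | hy <;> simp [hy]
  have hdi : Integrable (fun y => |(S y : ℝ) - n * p|) P := (hSi.sub (integrable_const _)).abs
  have hsi : Integrable (fun y => |√(S y : ℝ) - √p * √(n : ℝ)|) P := by
    refine (Integrable.sub (hSi.mono' (by fun_prop) (ae_of_all _ fun y => ?_))
      (integrable_const _)).abs
    rw [Real.norm_of_nonneg (Real.sqrt_nonneg _)]
    exact sqrt_natCast_le_self _
  have hm : √p * √(n : ℝ) = √(n * p) := by
    rw [mul_comm, Real.sqrt_mul (Nat.cast_nonneg n)]
  rw [← ofReal_integral_eq_lintegral_ofReal hsi (ae_of_all _ fun _ => abs_nonneg _),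
    ENNReal.ofReal_le_one]
  have hnp : 0 ≤ (n : ℝ) * p := by positivity
  rw [hm] at hsi ⊢
  rcases hnp.eq_or_lt with h0 | h0
  · rw [← h0] at hdev hdi hsi ⊢
    have h1 : √((n : ℝ) * (p * (1 - p))) = 0 := by rw [← mul_assoc, ← h0]; simp
    rw [h1] at hdev
    refine (integral_mono hsi hdi fun y => ?_).trans (hdev.trans zero_le_one)
    simp only [Real.sqrt_zero, sub_zero]
    rw [abs_of_nonneg (Real.sqrt_nonneg _), abs_of_nonneg (Nat.cast_nonneg _)]
    exact sqrt_natCast_le_self _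
  · have hs : 0 < √((n : ℝ) * p) := Real.sqrt_pos.2 h0
    have h1 : (∫ y, |√(S y : ℝ) - √(n * p)| ∂P) * √(n * p) ≤ √(n * p) := by
      rw [← integral_mul_const]
      refine (integral_mono (hsi.mul_const _) hdi fun y =>
        abs_sqrt_sub_sqrt_mul_sqrt_le (Nat.cast_nonneg _) hnp).trans (hdev.trans ?_)
      refine Real.sqrt_le_sqrt ?_
      rw [← mul_assoc]
      exact mul_le_of_le_one_right hnp (by linarith)
    exact le_of_mul_le_mul_right (by rwa [one_mul]) hs

end Deviation

namespace IsGINAR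

variable {Ω : Type*} [MeasurableSpace Ω] {μ : Measure Ω}
  {d : ℕ} {B : Matrix (Fin d) (Fin d) ℝ} {X Z : ℕ → Ω → Fin d → ℕ}
  {Y : ℕ → ℕ → Fin d → Fin d → Ω → ℕ}

/-- The deviation of the square root of `B i j ∘ X k j` from its scaled version. -/
noncomputable def thinDeviation (B : Matrix (Fin d) (Fin d) ℝ) (X : ℕ → Ω → Fin d → ℕ)
    (Y : ℕ → ℕ → Fin d → Fin d → Ω → ℕ) (k : ℕ) (i j : Fin d) (ω : Ω) : ℝ :=
  |√((∑ s ∈ Finset.range (X k ω j), Y (k + 1) (s + 1) i j ω : ℕ) : ℝ) -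
    √(B i j) * √(X k ω j : ℝ)|

theorem abs_sqrt_succ_sub_le (hX : IsGINAR μ B X Z Y) (k : ℕ) {c : Fin d → ℝ} (hc : ∀ j, 0 ≤ c j)
    {e : ℝ} (he : 0 ≤ e) (i : Fin d) :
    ∀ᵐ ω ∂μ, |√(X (k + 1) ω i : ℝ) - √(∑ j, B i j * c j ^ 2 + e ^ 2)| ≤
      ∑ j, (thinDeviation B X Y k i j ω + √(B i j) * |√(X k ω j : ℝ) - c j|) +
        |√(Z (k + 1) ω i : ℝ) - e| := by
  filter_upwards [hX.model k] with ω hω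
  have hB : ∀ j, 0 ≤ B i j := fun j => (hX.mem_unitInterval i j).1
  have hv : ∀ j, 0 ≤ B i j * c j ^ 2 := fun j => mul_nonneg (hB j) (sq_nonneg _)
  rw [hω i, Nat.cast_add, Nat.cast_sum]
  refine (abs_sqrt_add_sub_sqrt_add_le (Finset.sum_nonneg fun _ _ => Nat.cast_nonneg _)
    (Nat.cast_nonneg _) (Finset.sum_nonneg fun j _ => hv j) (sq_nonneg e)).trans ?_
  rw [Real.sqrt_sq he]
  gcongr
  refine (abs_sqrt_sum_sub_sqrt_sum_le _ (fun _ => Nat.cast_nonneg _) hv).trans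
    (Finset.sum_le_sum fun j _ => ?_)
  rw [Real.sqrt_mul (hB j), Real.sqrt_sq (hc j), ← abs_of_nonneg (Real.sqrt_nonneg (B i j)),
    ← abs_mul, mul_sub, abs_of_nonneg (Real.sqrt_nonneg (B i j))]
  exact abs_sub_le _ _ _

variable [IsProbabilityMeasure μ]

theorem thinDeviation_bound (hX : IsGINAR μ B X Z Y) (k : ℕ) (i j : Fin d) :
    Integrable (thinDeviation B X Y k i j) μ ∧ ∫ ω, thinDeviation B X Y k i j ω ∂μ ≤ 1 := by
  set F : ℕ × (ℕ × Fin d × Fin d → ℕ) → ℝ := fun q =>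
    |√((∑ s ∈ Finset.range q.1, q.2 (s, i, j) : ℕ) : ℝ) - √(B i j) * √(q.1 : ℝ)| with hF
  have hFm : Measurable F := measurable_from_prod_countable_right fun n => by
    simp only [hF]; fun_prop
  have hXm : Measurable fun ω => X k ω j := (measurable_pi_apply j).comp (hX.measurable_X k)
  have hNm : Measurable fun ω => (noise Z Y k ω).1 := (hX.measurable_noise k).fst
  have hind : IndepFun (fun ω => X k ω j) (fun ω => (noise Z Y k ω).1) μ :=
    (hX.indepFun_past_noiseFrom k).comp
      (φ := fun x : Set.Iic k → Fin d → ℕ => x ⟨k, Set.self_mem_Iic⟩ j)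
      (ψ := fun w : ℕ → Noise d => (w 0).1)
      ((measurable_pi_apply j).comp (measurable_pi_apply _)) (by fun_prop)
  have hD : thinDeviation B X Y k i j = fun ω => F (X k ω j, (noise Z Y k ω).1) := rfl
  have hDm : Measurable (thinDeviation B X Y k i j) := by
    rw [hD]; exact hFm.comp (hXm.prodMk hNm)
  have hD0 : ∀ ω, 0 ≤ thinDeviation B X Y k i j ω := fun ω => abs_nonneg _
  have hle : ∫⁻ ω, ENNReal.ofReal (thinDeviation B X Y k i j ω) ∂μ ≤ 1 := by
    have := Measure.isProbabilityMeasure_map (μ := μ) hXm.aemeasurable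
    have h := lintegral_indepFun hind hXm hNm hFm.ennreal_ofReal
    refine h.trans_le ?_
    rw [hX.map_counts k]
    refine (lintegral_mono fun n =>
      lintegral_abs_sqrt_sum_sub_le B hX.mem_unitInterval n i j).trans ?_
    simp
  have hi : Integrable (thinDeviation B X Y k i j) μ := by
    refine ⟨hDm.aestronglyMeasurable, ?_⟩
    rw [hasFiniteIntegral_iff_ofReal (ae_of_all _ hD0)]
    exact hle.trans_lt ENNReal.one_lt_top
  refine ⟨hi, ?_⟩
  rw [← ENNReal.ofReal_le_one, ofReal_integral_eq_lintegral_ofReal hi (ae_of_all _ hD0)]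
  exact hle

theorem integrable_sqrt (hX : IsGINAR μ B X Z Y) (hA : MomentCondition μ B (X 0) Z) (k : ℕ)
    (i : Fin d) : Integrable (fun ω => √(X k ω i : ℝ)) μ := by
  induction k generalizing i with
  | zero => exact hA.integrable_sqrt_X_zero i
  | succ k ih =>
    have hm : Measurable fun ω => √(X (k + 1) ω i : ℝ) :=
      (Measurable.of_discrete (f := fun n : ℕ => √(n : ℝ))).comp
        ((measurable_pi_apply i).comp (hX.measurable_X (k + 1)))
    refine Integrable.mono' (g := fun ω => ∑ j, (thinDeviation B X Y k i j ω +
      √(B i j) * |√(X k ω j : ℝ) - 0|) + |√(Z (k + 1) ω i : ℝ) - 0|) ?_ hm.aestronglyMeasurable ?_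
    · refine Integrable.add (integrable_finsetSum _ fun j _ =>
        (hX.thinDeviation_bound k i j).1.add (Integrable.const_mul ?_ _)) ?_
      · exact ((ih j).sub (integrable_const 0)).abs
      · exact ((hA.integrable_sqrt_Z k i).sub (integrable_const 0)).abs
    · filter_upwards [hX.abs_sqrt_succ_sub_le k (c := fun _ => 0) (fun _ => le_rfl) le_rfl i]
        with ω hω
      simpa using hω

/-- The square roots of the components of the process stay within a bounded mean distance of a
deterministic sequence. -/
theorem exists_centering (hX : IsGINAR μ B X Z Y) (hA : MomentCondition μ B (X 0) Z) :
    ∃ A : ℝ, 0 ≤ A ∧ ∃ c : ℕ → Fin d → ℝ, ∀ k i, ∫ ω, |√(X k ω i : ℝ) - c k i| ∂μ ≤ A := by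
  have hB : ∀ i j, 0 ≤ B i j := fun i j => (hX.mem_unitInterval i j).1
  obtain ⟨C, hC, hpow⟩ := exists_abs_pow_apply_le (sqrtMatrix B) (κ := 1 / 2) (by
    refine hA.rho_lt.trans_eq ?_
    rw [ENNReal.ofReal_div_of_pos two_pos]; simp)
  choose ζ hζ using hA.bounded_Z
  set e : ℕ → Fin d → ℝ := fun k i => ∫ ω, √(Z (k + 1) ω i : ℝ) ∂μ with he
  have he0 : ∀ k i, 0 ≤ e k i := fun k i => integral_nonneg fun _ => Real.sqrt_nonneg _
  let c : ℕ → Fin d → ℝ := fun k => Nat.rec (fun _ => 0)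
    (fun k v i => √(∑ j, B i j * v j ^ 2 + e k i ^ 2)) k
  have hc0 : ∀ k i, 0 ≤ c k i := fun k i => by
    cases k with
    | zero => exact le_rfl
    | succ k => exact Real.sqrt_nonneg _
  have hint : ∀ k i, Integrable (fun ω => |√(X k ω i : ℝ) - c k i|) μ := fun k i =>
    ((hX.integrable_sqrt hA k i).sub (integrable_const _)).abs
  have hrec : ∀ k i, ∫ ω, |√(X (k + 1) ω i : ℝ) - c (k + 1) i| ∂μ ≤
      ∑ j, sqrtMatrix B i j * ∫ ω, |√(X k ω j : ℝ) - c k j| ∂μ + (∑ _j : Fin d, 1 + ζ i) := by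
    intro k i
    have hDi := fun j => hX.thinDeviation_bound k i j
    have hterm : ∀ j ∈ Finset.univ, Integrable (fun ω => thinDeviation B X Y k i j ω +
        √(B i j) * |√(X k ω j : ℝ) - c k j|) μ := fun j _ =>
      (hDi j).1.add ((hint k j).const_mul _)
    have hZi : Integrable (fun ω => |√(Z (k + 1) ω i : ℝ) - e k i|) μ :=
      ((hA.integrable_sqrt_Z k i).sub (integrable_const _)).abs
    calc ∫ ω, |√(X (k + 1) ω i : ℝ) - c (k + 1) i| ∂μ
        ≤ ∫ ω, (∑ j, (thinDeviation B X Y k i j ω + √(B i j) * |√(X k ω j : ℝ) - c k j|) +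
          |√(Z (k + 1) ω i : ℝ) - e k i|) ∂μ :=
          integral_mono_ae (hint (k + 1) i) ((integrable_finsetSum _ hterm).add hZi)
            (hX.abs_sqrt_succ_sub_le k (hc0 k) (he0 k i) i)
      _ = ∑ j, (∫ ω, thinDeviation B X Y k i j ω ∂μ +
            √(B i j) * ∫ ω, |√(X k ω j : ℝ) - c k j| ∂μ) +
          ∫ ω, |√(Z (k + 1) ω i : ℝ) - e k i| ∂μ := by
          rw [integral_add (integrable_finsetSum _ hterm) hZi, integral_finsetSum _ hterm]
          congr 1
          refine Finset.sum_congr rfl fun j _ => ?_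
          rw [integral_add (hDi j).1 ((hint k j).const_mul _), integral_const_mul]
      _ ≤ ∑ j, (1 + √(B i j) * ∫ ω, |√(X k ω j : ℝ) - c k j| ∂μ) + ζ i :=
          add_le_add (Finset.sum_le_sum fun j _ => by have := (hDi j).2; gcongr) (hζ i k)
      _ = _ := by
          rw [Finset.sum_add_distrib]
          simp only [sqrtMatrix, Matrix.map_apply]
          ring
  obtain ⟨A, hA0, hAb⟩ := exists_bound_of_affine_recursion (M := sqrtMatrix B)
    (fun i j => Real.sqrt_nonneg _) hC (by norm_num) (by norm_num) hpow
    (fun k i => ∫ ω, |√(X k ω i : ℝ) - c k i| ∂μ) (fun i => ∑ _j : Fin d, 1 + ζ i) hrec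
  exact ⟨A, hA0, c, hAb⟩

/-- The conditional probability of a future event given the past, as a function of the present. -/
theorem exists_transition (hX : IsGINAR μ B X Z Y) (k n : ℕ) :
    ∃ L : Measure (Fin d → ℕ), IsProbabilityMeasure L ∧
      ∀ C, MeasurableSet[future X (k + n)] C → ∃ h : (Fin d → ℕ) → ℝ, (∀ x, h x ∈ Set.Icc 0 1) ∧
        (μ⟦C | past X k⟧ =ᵐ[μ] fun ω =>
          ∫ z, h z ∂(descendantLaw B hX.mem_unitInterval n (X k ω) ∗ L)) ∧
        μ.real C = ∫ ω, ∫ z, h z ∂(descendantLaw B hX.mem_unitInterval n (X k ω) ∗ L) ∂μ := by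
  obtain ⟨L, hL, htraj⟩ := hX.exists_map_traj k n
  refine ⟨L, hL, fun C hC => ?_⟩
  obtain ⟨A, hA, rfl⟩ := exists_of_measurableSet_future X (k + n) hC
  have hnf := hX.measurable_noiseFrom
  set h : (Fin d → ℕ) → ℝ := fun y => μ.real {ω | (fun m => traj y (noiseFrom Z Y (k + n) ω) m) ∈ A}
    with hh
  set g : (Fin d → ℕ) → ℝ := fun x => μ.real {ω | (fun m => traj x (noiseFrom Z Y k ω) (n + m)) ∈ A}
    with hg
  have hgh : ∀ x, g x = ∫ z, h z ∂(descendantLaw B hX.mem_unitInterval n x ∗ L) := fun x => by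
    have hD : MeasurableSet {q : (Fin d → ℕ) × (ℕ → Noise d) | (fun m => traj q.1 q.2 m) ∈ A} :=
      (measurable_of_forall_apply fun m => measurable_traj measurable_fst measurable_snd m) hA
    have h1 := measureReal_indepFun (hX.indepFun_traj_noiseFrom x k n)
      (measurable_traj measurable_const (hnf k) n) (hnf (k + n)) hD
    rw [htraj x] at h1
    refine Eq.trans ?_ h1
    have h2 : ∀ ω, (fun l => noiseFrom Z Y k ω (n + l)) = noiseFrom Z Y (k + n) ω := fun ω => by
      ext1 l; simp only [noiseFrom, add_assoc]
    simp only [hg, traj_add, h2]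
    rfl
  set T : Ω → Set.Iic k → Fin d → ℕ := fun ω j => X j ω with hT
  have hTm : Measurable T := measurable_of_forall_apply fun j => hX.measurable_X j
  have hD : MeasurableSet {q : (Set.Iic k → Fin d → ℕ) × (ℕ → Noise d) |
      (fun m => traj (q.1 ⟨k, Set.self_mem_Iic⟩) q.2 (n + m)) ∈ A} :=
    (measurable_of_forall_apply fun m => measurable_traj
      ((measurable_pi_apply (⟨k, Set.self_mem_Iic⟩ : Set.Iic k)).comp measurable_fst)
      measurable_snd (n + m)) hA
  have hind := hX.indepFun_past_noiseFrom k
  have hCD : ({ω | (fun l => X (k + n + l) ω) ∈ A} : Set Ω) =ᵐ[μ]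
      {ω | (T ω, noiseFrom Z Y k ω) ∈ {q : (Set.Iic k → Fin d → ℕ) × (ℕ → Noise d) |
        (fun m => traj (q.1 ⟨k, Set.self_mem_Iic⟩) q.2 (n + m)) ∈ A}} := by
    filter_upwards [hX.ae_eq_traj k] with ω hω
    have : (fun l => X (k + n + l) ω) =
        fun m => traj (X k ω) (noiseFrom Z Y k ω) (n + m) := by
      ext1 l; rw [add_assoc, hω]
    refine propext ?_
    change (fun l => X (k + n + l) ω) ∈ A ↔ _
    rw [this]
    rfl
  refine ⟨h, fun x => ⟨measureReal_nonneg, measureReal_le_one⟩, ?_, ?_⟩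
  · simp only [← hgh]
    rw [past_eq_comap]
    exact (condExp_congr_ae (indicator_ae_eq_of_ae_eq_set hCD)).trans
      (condExp_indepFun hind hTm (hnf k) hD)
  · simp only [← hgh]
    rw [measureReal_congr hCD, measureReal_indepFun hind hTm (hnf k) hD,
      integral_map hTm.aemeasurable (Measurable.of_discrete).aestronglyMeasurable]
    rfl

theorem betaAt_le_lintegral (hX : IsGINAR μ B X Z Y) (k n : ℕ) (b : (Fin d → ℕ) → ℝ≥0∞)
    (hb : ∀ L : Measure (Fin d → ℕ), IsProbabilityMeasure L → ∀ h : (Fin d → ℕ) → ℝ,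
      (∀ x, h x ∈ Set.Icc 0 1) → ∀ x, ENNReal.ofReal
        |∫ z, h z ∂(descendantLaw B hX.mem_unitInterval n x ∗ L) -
          ∫ ω, ∫ z, h z ∂(descendantLaw B hX.mem_unitInterval n (X k ω) ∗ L) ∂μ| ≤ b x) :
    betaAt μ X k n ≤ ∫⁻ ω, b (X k ω) ∂μ := by
  obtain ⟨L, hL, hC⟩ := hX.exists_transition k n
  rw [betaAt, past_eq_comap]
  refine betaCoeff_comap_le _ (T := fun ω (j : Set.Iic k) => X j ω)
    (fun t => b (t ⟨k, Set.self_mem_Iic⟩)) fun C hCm => ?_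
  obtain ⟨h, h01, hcond, hreal⟩ := hC C hCm
  rw [past_eq_comap] at hcond
  refine ⟨fun t => ∫ z, h z ∂(descendantLaw B hX.mem_unitInterval n (t ⟨k, Set.self_mem_Iic⟩) ∗ L),
    hcond, fun t => ?_⟩
  rw [hreal]
  exact hb L hL h h01 _

theorem integral_descendantLaw_conv_mem_Icc (hB : ∀ i j, B i j ∈ unitInterval) (n : ℕ)
    (x : Fin d → ℕ) {L : Measure (Fin d → ℕ)} (hL : IsProbabilityMeasure L) {h : (Fin d → ℕ) → ℝ}
    (h01 : ∀ x, h x ∈ Set.Icc 0 1) :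
    ∫ z, h z ∂(descendantLaw B hB n x ∗ L) ∈ Set.Icc (0 : ℝ) 1 := by
  have := (isBranching_descendantLaw B hB n).prob x
  refine ⟨integral_nonneg fun z => (h01 z).1, ?_⟩
  refine (integral_mono_of_nonneg (ae_of_all _ fun z => (h01 z).1) (integrable_const (1 : ℝ))
    (ae_of_all _ fun z => (h01 z).2)).trans ?_
  simp

theorem integrable_transition (hX : IsGINAR μ B X Z Y) (k n : ℕ)
    {L : Measure (Fin d → ℕ)} (hL : IsProbabilityMeasure L) {h : (Fin d → ℕ) → ℝ}
    (h01 : ∀ x, h x ∈ Set.Icc 0 1) :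
    Integrable (fun ω => ∫ z, h z ∂(descendantLaw B hX.mem_unitInterval n (X k ω) ∗ L)) μ := by
  refine Integrable.of_bound (C := 1) ((Measurable.of_discrete (f := fun x =>
    ∫ z, h z ∂(descendantLaw B hX.mem_unitInterval n x ∗ L))).comp
      (hX.measurable_X k)).aestronglyMeasurable (ae_of_all _ fun ω => ?_)
  have := integral_descendantLaw_conv_mem_Icc hX.mem_unitInterval n (X k ω) hL h01
  rw [Real.norm_of_nonneg this.1]
  exact this.2

theorem betaAt_le_one (hX : IsGINAR μ B X Z Y) (k n : ℕ) : betaAt μ X k n ≤ 1 := by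
  refine (hX.betaAt_le_lintegral k n (fun _ => 1) fun L hL h h01 x => ?_).trans (by simp)
  rw [ENNReal.ofReal_le_one]
  have hg := fun y => integral_descendantLaw_conv_mem_Icc hX.mem_unitInterval n y hL h01
  have h0 : 0 ≤ ∫ ω, ∫ z, h z ∂(descendantLaw B hX.mem_unitInterval n (X k ω) ∗ L) ∂μ :=
    integral_nonneg fun ω => (hg _).1
  have h1 : ∫ ω, ∫ z, h z ∂(descendantLaw B hX.mem_unitInterval n (X k ω) ∗ L) ∂μ ≤ 1 := by
    refine (integral_mono (hX.integrable_transition k n hL h01) (integrable_const (1 : ℝ))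
      fun ω => (hg _).2).trans (by simp)
  rw [abs_le]
  constructor <;> linarith [(hg x).1, (hg x).2]

/-- If individuals rarely have `n`-step descendants, the mixing coefficient is controlled by the
spread of the square roots of the process. -/
theorem betaAt_le_of_descendants (hX : IsGINAR μ B X Z Y) (hA : MomentCondition μ B (X 0) Z)
    {c : Fin d → ℝ} {A ε : ℝ} {k n : ℕ} (hc : ∀ i, ∫ ω, |√(X k ω i : ℝ) - c i| ∂μ ≤ A)
    (hε : 0 ≤ ε)
    (hq : ∀ j, (descendantLaw B hX.mem_unitInterval n (Pi.single j 1)).real {0}ᶜ ≤ 1 / 2)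
    (hqε : ∀ j, √(2 * (descendantLaw B hX.mem_unitInterval n (Pi.single j 1)).real {0}ᶜ) ≤ ε) :
    betaAt μ X k n ≤ ENNReal.ofReal (4 * d * A * ε) := by
  set D : Fin d → Ω → ℝ := fun j ω => |√(X k ω j : ℝ) - c j| with hD
  have hDi : ∀ j, Integrable (D j) μ := fun j =>
    ((hX.integrable_sqrt hA k j).sub (integrable_const _)).abs
  set b : (Fin d → ℕ) → ℝ := fun x => ∑ j, 2 * ε * (|√(x j : ℝ) - c j| + ∫ ω, D j ω ∂μ) with hb
  have hb0 : ∀ x, 0 ≤ b x := fun x => Finset.sum_nonneg fun j _ => by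
    have : 0 ≤ ∫ ω, D j ω ∂μ := integral_nonneg fun _ => abs_nonneg _
    positivity
  have hterm : ∀ j ∈ Finset.univ, Integrable (fun ω => 2 * ε * (D j ω + ∫ ω', D j ω' ∂μ)) μ :=
    fun j _ => ((hDi j).add (integrable_const _)).const_mul _
  have hbi : Integrable (fun ω => b (X k ω)) μ := integrable_finsetSum _ hterm
  refine (hX.betaAt_le_lintegral k n (fun x => ENNReal.ofReal (b x)) fun L hL h h01 x =>
    ENNReal.ofReal_le_ofReal ?_).trans ?_
  · set g : (Fin d → ℕ) → ℝ := fun x =>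
      ∫ z, h z ∂(descendantLaw B hX.mem_unitInterval n x ∗ L)
    have hgi : Integrable (fun ω => g (X k ω)) μ := hX.integrable_transition k n hL h01
    have hlip : ∀ y, |g x - g y| ≤ ∑ j, 2 * ε * |√(x j : ℝ) - √(y j : ℝ)| := fun y =>
      ((isBranching_descendantLaw B hX.mem_unitInterval n).abs_integral_conv_sub_le L
        (fun z => abs_le.2 ⟨by linarith [(h01 z).1], (h01 z).2⟩) hq x y).trans
        (Finset.sum_le_sum fun j _ => by
          have := hqε j
          gcongr)
    have h1 : g x - ∫ ω, g (X k ω) ∂μ = ∫ ω, (g x - g (X k ω)) ∂μ := by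
      rw [integral_sub (integrable_const _) hgi]; simp
    have hti : ∀ j ∈ Finset.univ,
        Integrable (fun ω => 2 * ε * (|√(x j : ℝ) - c j| + D j ω)) μ := fun j _ =>
      ((integrable_const _).add (hDi j)).const_mul _
    change |g x - ∫ ω, g (X k ω) ∂μ| ≤ b x
    rw [h1]
    refine abs_integral_le_integral_abs.trans ?_
    refine (integral_mono (((integrable_const _).sub hgi).abs) (integrable_finsetSum _ hti)
      fun ω => (hlip (X k ω)).trans (Finset.sum_le_sum fun j _ => ?_)).trans_eq ?_
    · refine mul_le_mul_of_nonneg_left ?_ (by positivity)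
      simp only [hD]
      rw [abs_sub_comm (√(X k ω j : ℝ))]
      exact abs_sub_le _ _ _
    · rw [integral_finsetSum _ hti]
      refine Finset.sum_congr rfl fun j _ => ?_
      rw [integral_const_mul, integral_add (integrable_const _) (hDi j)]
      simp
  · rw [← ofReal_integral_eq_lintegral_ofReal hbi (ae_of_all _ fun ω => hb0 _)]
    refine ENNReal.ofReal_le_ofReal ?_
    have h2 : ∫ ω, b (X k ω) ∂μ = ∑ j, 2 * ε * (2 * ∫ ω, D j ω ∂μ) := by
      refine (integral_finsetSum _ hterm).trans (Finset.sum_congr rfl fun j _ => ?_)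
      rw [integral_const_mul, integral_add (hDi j) (integrable_const _)]
      simp [two_mul]
    rw [h2]
    calc ∑ j, 2 * ε * (2 * ∫ ω, D j ω ∂μ) ≤ ∑ _j : Fin d, 2 * ε * (2 * A) :=
          Finset.sum_le_sum fun j _ => by have := hc j; gcongr
      _ = 4 * d * A * ε := by simp; ring

/-- The mixing coefficients decay geometrically, at every rate above `ρ(√B)`. -/
theorem exists_beta_le (hX : IsGINAR μ B X Z Y) (hA : MomentCondition μ B (X 0) Z) {κ : ℝ}
    (hκ : rho (sqrtMatrix B) < ENNReal.ofReal κ) :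
    ∃ C : ℝ≥0, ∀ n, beta μ X n ≤ C * ENNReal.ofReal κ ^ n := by
  have hκ0 : 0 < κ := ENNReal.ofReal_pos.1 (lt_of_le_of_lt zero_le hκ)
  have hB : ∀ i j, 0 ≤ B i j := fun i j => (hX.mem_unitInterval i j).1
  obtain ⟨C, hC, hpow⟩ := exists_abs_pow_apply_le (sqrtMatrix B) hκ
  obtain ⟨A, hA0, c, hc⟩ := hX.exists_centering hA
  have hq : ∀ n j, (descendantLaw B hX.mem_unitInterval n (Pi.single j 1)).real {0}ᶜ ≤
      (d * C * κ ^ n) ^ 2 := fun n j => by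
    refine (descendantLaw_single_real_le B hX.mem_unitInterval n j).trans ?_
    refine (Finset.sum_le_sum fun i _ => pow_apply_le_sqrtMatrix_pow_sq hB n i j).trans ?_
    refine (sum_sq_le_sq_sum_of_nonneg _ _ fun i _ => sqrtMatrix_pow_nonneg B n i j).trans ?_
    refine pow_le_pow_left₀ (Finset.sum_nonneg fun i _ => sqrtMatrix_pow_nonneg B n i j) ?_ 2
    refine (Finset.sum_le_sum fun i _ => (le_abs_self _).trans (hpow n i j)).trans ?_
    simp [mul_assoc]
  refine ⟨(2 * (d * C) * (1 + 4 * d * A)).toNNReal, fun n => iSup_le fun k => ?_⟩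
  have hε : 0 ≤ 2 * (d * C * κ ^ n) := by positivity
  change _ ≤ ENNReal.ofReal _ * _
  rw [← ENNReal.ofReal_pow hκ0.le, ← ENNReal.ofReal_mul (by positivity)]
  by_cases hhalf : ∀ j, (descendantLaw B hX.mem_unitInterval n (Pi.single j 1)).real {0}ᶜ ≤ 1 / 2
  · refine (hX.betaAt_le_of_descendants hA (hc k) hε hhalf fun j => ?_).trans
      (ENNReal.ofReal_le_ofReal ?_)
    · refine Real.sqrt_le_iff.2 ⟨hε, ?_⟩
      have := hq n j
      nlinarith [sq_nonneg (d * C * κ ^ n)]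
    · nlinarith
  · push Not at hhalf
    obtain ⟨j, hj⟩ := hhalf
    refine (hX.betaAt_le_one k n).trans ?_
    rw [ENNReal.one_le_ofReal]
    have h1 : 1 ≤ 2 * (d * C * κ ^ n) := by
      by_contra! hlt
      have h2 : 0 ≤ d * C * κ ^ n := by positivity
      have := hq n j
      nlinarith
    have h3 : 0 ≤ 4 * (d : ℝ) * A := by positivity
    nlinarith

end IsGINAR

end CountProcess

theorem theorem3 {Ω : Type*} [MeasurableSpace Ω] (μ : Measure Ω) [IsProbabilityMeasure μ]
    {d : ℕ} (B : Matrix (Fin d) (Fin d) ℝ)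
    (X : ℕ → Ω → Fin d → ℕ) (Z : ℕ → Ω → Fin d → ℕ) (Y : ℕ → ℕ → Fin d → Fin d → Ω → ℕ)
    (hX : CountProcess.IsGINAR μ B X Z Y)
    (hA : CountProcess.MomentCondition μ B (X 0) Z) :
    CountProcess.AbsolutelyRegular μ X ∧
    ∀ κ : ℝ, 2 * CountProcess.rho (CountProcess.sqrtMatrix B) < ENNReal.ofReal κ →
      ∃ C : ℝ≥0, ∀ n : ℕ, CountProcess.beta μ X n ≤ C * ENNReal.ofReal κ ^ n := by
  constructor
  · have hhalf : ENNReal.ofReal (1 / 2) = 1 / 2 := by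
      rw [ENNReal.ofReal_div_of_pos two_pos]; simp
    obtain ⟨C, hC⟩ := hX.exists_beta_le hA (κ := 1 / 2) (by rw [hhalf]; exact hA.rho_lt)
    have hlim : Tendsto (fun n : ℕ => (C : ℝ≥0∞) * ENNReal.ofReal (1 / 2) ^ n) atTop (𝓝 0) := by
      have h := ENNReal.Tendsto.const_mul (a := (C : ℝ≥0∞))
        (ENNReal.tendsto_pow_atTop_nhds_zero_of_lt_one (r := ENNReal.ofReal (1 / 2)) (by
          rw [ENNReal.ofReal_lt_one]; norm_num)) (Or.inr ENNReal.coe_ne_top)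
      rwa [mul_zero] at h
    exact tendsto_of_tendsto_of_tendsto_of_le_of_le tendsto_const_nhds hlim
      (fun _ => zero_le) hC
  · intro κ hκ
    refine hX.exists_beta_le hA (lt_of_le_of_lt ?_ hκ)
    rw [two_mul]
    exact le_self_add
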